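/- A \emph{graded space} is a finite-dimensional smooth (Hausdorff, second countable) manifold $V$ with a smooth action $h:\mathbb{R}\times V\to V$ of the multiplicative monoid $(\mathbb{R},\cdot)$ such that $h_0$ is a constant map; morphisms of graded spaces are the smooth maps intertwining the actions. For $\mathbf{d}=(d_1,\dots,d_r)$ with $r\ge 0$ and integers $d_w\ge 0$, let $\mathcal{A}(\mathbb{R}^{\mathbf d})=\mathbb{R}[y^a_w : 1\le w\le r,\ 1\le a\le d_w]$, graded by giving $y^a_w$ degree $w$. A \emph{graded polynomial algebra} is an $\mathbb{N}$-graded commutative unital $\mathbb{R}$-algebra $A=\bigoplus_{i\ge0}A^i$ isomorphic, as a graded algebra, with $\mathcal{A}(\mathbb{R}^{\mathbf d})$ for some $\mathbf d$; morphisms are the homomorphisms of graded unital algebras. On $\mathbb{R}[\varepsilon]$ take the grading $\mathbb{R}[\varepsilon]=\bigoplus_i\mathbb{R}\varepsilon^i$ and the action $h_t(\varepsilon^i)=t^i\varepsilon^i$; a map into $\mathbb{R}[\varepsilon]$ is smooth if for every $k\ge 0$ its first $k+1$ coefficients form a smooth map into $\mathbb{R}^{k+1}$. For a graded space $V$ let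 $\mathrm{Hom}_{\mathbb G}(V,\mathbb{R}[\varepsilon])$ be the algebra (under pointwise operations) of smooth maps $\alpha:V\to\mathbb{R}[\varepsilon]$ with $\alpha\circ h_t=h_t\circ\alpha$ for all $t\in\mathbb{R}$, its degree $i$ part being the maps with values in $\mathbb{R}\varepsilon^i$. For a graded polynomial algebra $A$ let $\mathrm{Hom}_{gr}(A,\mathbb{R}[\varepsilon])$ be the set of graded algebra homomorphisms $\psi: A\to\mathbb{R}[\varepsilon]$, with the action $(h_t\psi)(a)=h_t(\psi(a))$. A morphism $f:V\to W$ of graded spaces induces $\alpha\mapsto\alpha\circ f$, and a morphism $\phi:A\to B$ of graded polynomial algebras induces $\zeta\mapsto\zeta\circ\phi$. Then: 1. For every graded space $V$, $\mathrm{Hom}_{\mathbb G}(V,\mathbb{R}[\varepsilon])$ is a graded polynomial algebra. 2. For every graded polynomial algebra $A$, $\mathrm{Hom}_{gr}(A,\mathbb{R}[\varepsilon])$ is a graded space, for the smooth structure in which, for every graded isomorphism $A\cong\mathcal{A}(\mathbb{R}^{\mathbf d})$, the bijection $\psi\mapsto(\lambda^a_w)$ onto $\mathbb{R}^{\mathbf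 d}=\mathbb{R}^{d_1}\times\dots\times\mathbb{R}^{d_r}$ given by $\psi(y^a_w)=\lambda^a_w\varepsilon^w$ is a diffeomorphism; it intertwines $h_t$ with $(\lambda^a_w)\mapsto(t^w\lambda^a_w)$. 3. The evaluation maps $\mathrm{ev}_V:V\to\mathrm{Hom}_{gr}(\mathrm{Hom}_{\mathbb G}(V,\mathbb{R}[\varepsilon]),\mathbb{R}[\varepsilon])$, $v\mapsto(\alpha\mapsto\alpha(v))$, and $\mathrm{ev}_A:A\to\mathrm{Hom}_{\mathbb G}(\mathrm{Hom}_{gr}(A,\mathbb{R}[\varepsilon]),\mathbb{R}[\varepsilon])$, $a\mapsto(\psi\mapsto\psi(a))$, are natural isomorphisms of graded spaces and of graded algebras, respectively. 4. The functors $\mathrm{Hom}_{\mathbb G}(\cdot,\mathbb{R}[\varepsilon])$ and $\mathrm{Hom}_{gr}(\cdot,\mathbb{R}[\varepsilon])$ form an equivalence between the category of graded spaces and the opposite of the category of graded polynomial algebras. -/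

import Mathlib

open CategoryTheory Opposite
open scoped Manifold ContDiff DirectSum

universe u

noncomputable section

/-! ## The model space `𝔸 = ℝ[ε]` -/

/-- The degree `i` part `ℝ · ε ^ i` of `ℝ[ε]`. -/
def epsPiece (i : ℕ) : Submodule ℝ (Polynomial ℝ) :=
  LinearMap.range (Polynomial.monomial i)

lemma mem_epsPiece {i : ℕ} {p : Polynomial ℝ} :
    p ∈ epsPiece i ↔ ∃ r : ℝ, Polynomial.monomial i r = p := Iff.rfl

lemma X_mem_epsPiece : (Polynomial.X : Polynomial ℝ) ∈ epsPiece 1 := ⟨1, rfl⟩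

instance epsPiece_gradedMonoid : SetLike.GradedMonoid epsPiece where
  one_mem := ⟨1, rfl⟩
  mul_mem := by
    rintro i j _ _ ⟨a, rfl⟩ ⟨b, rfl⟩
    exact ⟨a * b, (Polynomial.monomial_mul_monomial i j a b).symm⟩

/-- The canonical grading `ℝ[ε] = ⨁ ℝ · ε ^ i`. -/
instance epsPiece_gradedAlgebra : GradedAlgebra epsPiece :=
  GradedAlgebra.ofAlgHom epsPiece
    (Polynomial.aeval (DirectSum.of (fun i => epsPiece i) 1 ⟨Polynomial.X, X_mem_epsPiece⟩))
    (by
      ext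
      simp)
    (by
      rintro i ⟨_, r, rfl⟩
      change Polynomial.aeval _ (Polynomial.monomial i r) = _
      rw [Polynomial.aeval_monomial, DirectSum.ofPow, ← Algebra.smul_def,
        ← DirectSum.lof_eq_of ℝ, ← map_smul, DirectSum.lof_eq_of]
      apply DirectSum.of_eq_of_gradedMonoid_eq
      refine Sigma.subtype_ext (mul_one i) ?_
      change r • (Polynomial.X : Polynomial ℝ) ^ i = Polynomial.monomial i r
      rw [Polynomial.smul_eq_C_mul, Polynomial.C_mul_X_pow_eq_monomial])

/-- The homogeneity structure of `ℝ[ε]`: `h_t (ε ^ i) = t ^ i ε ^ i`. -/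
def epsScale (t : ℝ) : Polynomial ℝ →ₐ[ℝ] Polynomial ℝ :=
  Polynomial.aeval (Polynomial.C t * Polynomial.X)

lemma epsScale_monomial (t : ℝ) (i : ℕ) (r : ℝ) :
    epsScale t (Polynomial.monomial i r) = Polynomial.monomial i (t ^ i * r) := by
  rw [epsScale, Polynomial.aeval_monomial, mul_pow, ← Polynomial.C_pow, ← mul_assoc]
  rw [← Polynomial.C_mul_X_pow_eq_monomial, ← Polynomial.C_eq_algebraMap, ← Polynomial.C_mul,
    mul_comm r]

lemma epsScale_one : epsScale 1 = AlgHom.id ℝ _ := by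
  ext
  simp [epsScale]

lemma epsScale_mul (s t : ℝ) : epsScale (s * t) = (epsScale s).comp (epsScale t) := by
  apply Polynomial.algHom_ext
  simp only [epsScale, AlgHom.comp_apply, Polynomial.aeval_X, map_mul, Polynomial.aeval_C,
    Polynomial.algebraMap_eq]
  ring

/-- `h_t` as a graded algebra homomorphism. -/
def epsScaleGr (t : ℝ) : epsPiece →ₐᵍ[ℝ] epsPiece :=
  ⟨epsScale t, by
    rintro i _ ⟨r, rfl⟩
    exact ⟨t ^ i * r, (epsScale_monomial t i r).symm⟩⟩

/-! ## Graded spaces -/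

/-- A graded space: a smooth (Hausdorff, second countable, finite dimensional) manifold with a
smooth action `h` of the multiplicative monoid `(ℝ, ·)` such that `h_0` is constant. -/
structure GradedSpace : Type (u + 1) where
  carrier : Type u
  dim : ℕ
  [topology : TopologicalSpace carrier]
  [hausdorff : T2Space carrier]
  [secondCountable : SecondCountableTopology carrier]
  [charted : ChartedSpace (EuclideanSpace ℝ (Fin dim)) carrier]
  [manifold : IsManifold (𝓡 dim) ∞ carrier]
  [action : MulAction ℝ carrier]
  [smooth_action : ContMDiffSMul 𝓘(ℝ, ℝ) (𝓡 dim) ∞ ℝ carrier]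
  zero_smul_const : ∃ o : carrier, ∀ v : carrier, (0 : ℝ) • v = o

namespace GradedSpace

attribute [instance] topology hausdorff secondCountable charted manifold action smooth_action

/-- Morphisms of graded spaces: smooth maps intertwining the actions of `(ℝ, ·)`. -/
@[ext]
structure Hom (V W : GradedSpace.{u}) : Type u where
  toFun : V.carrier → W.carrier
  smooth : ContMDiff (𝓡 V.dim) (𝓡 W.dim) ∞ toFun
  map_smul : ∀ (t : ℝ) (v : V.carrier), toFun (t • v) = t • toFun v

instance : Category.{u} GradedSpace.{u} where
  Hom V W := Hom V W
  id V := ⟨id, contMDiff_id, fun _ _ => rfl⟩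
  comp f g := ⟨g.toFun ∘ f.toFun, g.smooth.comp f.smooth, fun t v => by
    simp [f.map_smul, g.map_smul]⟩

/-- A function `α : V → ℝ[ε]` is smooth if for every `k` its composition with the projection
`ℝ[ε] → ℝ[ε] / ⟨ε ^ (k + 1)⟩ ≃ ℝ ^ (k + 1)` onto the first `k + 1` coefficients is smooth. -/
def SmoothToEps (V : GradedSpace.{u}) (α : V.carrier → Polynomial ℝ) : Prop :=
  ∀ k : ℕ, ContMDiff (𝓡 V.dim) 𝓘(ℝ, Fin (k + 1) → ℝ) ∞
    (fun v => fun i : Fin (k + 1) => (α v).coeff i)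

lemma smoothToEps_iff (V : GradedSpace.{u}) (α : V.carrier → Polynomial ℝ) :
    V.SmoothToEps α ↔ ∀ i : ℕ, ContMDiff (𝓡 V.dim) 𝓘(ℝ, ℝ) ∞ (fun v => (α v).coeff i) := by
  constructor
  · intro h i
    exact contMDiff_pi_space.1 (h i) (Fin.last i)
  · intro h k
    exact contMDiff_pi_space.2 fun i => h i

/-- `Hom_𝔾(V, ℝ[ε])`: the algebra of smooth functions `V → ℝ[ε]` intertwining the homogeneity
structures, with pointwise operations. -/
def dual (V : GradedSpace.{u}) : Subalgebra ℝ (V.carrier → Polynomial ℝ) where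
  carrier := {α | V.SmoothToEps α ∧ ∀ (t : ℝ) (v : V.carrier), α (t • v) = epsScale t (α v)}
  mul_mem' := by
    rintro α β ⟨hα, hα'⟩ ⟨hβ, hβ'⟩
    rw [smoothToEps_iff] at hα hβ
    refine ⟨(smoothToEps_iff _ _).2 fun i => ?_, fun t v => by simp [hα', hβ']⟩
    simp only [Pi.mul_apply, Polynomial.coeff_mul]
    exact contMDiff_finsetSum fun p _ => (hα p.1).mul (hβ p.2)
  add_mem' := by
    rintro α β ⟨hα, hα'⟩ ⟨hβ, hβ'⟩
    rw [smoothToEps_iff] at hα hβ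
    refine ⟨(smoothToEps_iff _ _).2 fun i => ?_, fun t v => by simp [hα', hβ']⟩
    simp only [Pi.add_apply, Polynomial.coeff_add]
    exact (hα i).add (hβ i)
  algebraMap_mem' r := by
    refine ⟨(smoothToEps_iff _ _).2 fun i => contMDiff_const, fun t v => ?_⟩
    simp only [Pi.algebraMap_apply, AlgHom.commutes]

/-- The degree `i` part of `Hom_𝔾(V, ℝ[ε])`: the functions with values in `ℝ · ε ^ i`. -/
def dualPiece (V : GradedSpace.{u}) (i : ℕ) : Submodule ℝ V.dual where
  carrier := {α | ∀ v, α.1 v ∈ epsPiece i}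
  add_mem' hα hβ v := add_mem (hα v) (hβ v)
  zero_mem' _ := zero_mem _
  smul_mem' r _ hα v := Submodule.smul_mem _ r (hα v)

/-- The dual morphism `α ↦ α ∘ f`. -/
def dualMap {V W : GradedSpace.{u}} (f : V ⟶ W) : W.dual →ₐ[ℝ] V.dual where
  toFun α := ⟨α.1 ∘ f.toFun, (smoothToEps_iff _ _).2 fun i =>
    ((smoothToEps_iff _ _).1 α.2.1 i).comp f.smooth, fun t v => by
      simp only [Function.comp_apply, f.map_smul, α.2.2]⟩
  map_one' := rfl
  map_mul' _ _ := rfl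
  map_zero' := rfl
  map_add' _ _ := rfl
  commutes' _ := rfl

end GradedSpace

/-! ## Graded polynomial algebras -/

/-- The index set of the coordinates `y ^ a_w` (`1 ≤ w ≤ r`, `1 ≤ a ≤ d_w`) on
`ℝ ^ 𝐝 = ℝ ^ d_1 × ⋯ × ℝ ^ d_r`. -/
abbrev CoordIndex {r : ℕ} (d : Fin r → ℕ) : Type := Σ i : Fin r, Fin (d i)

/-- The weight of a coordinate; `Fin r` is numbered from `0`, weights start at `1`. -/
def coordWeight {r : ℕ} (d : Fin r → ℕ) (s : CoordIndex d) : ℕ := (s.1 : ℕ) + 1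

/-- A graded algebra isomorphism between `A` (with homogeneous parts `𝒜 i`) and
`𝒜(ℝ ^ 𝐝) = ℝ[y ^ a_w]`, graded by the weights of the coordinates. -/
structure GradedCoordinates {A : Type*} [CommRing A] [Algebra ℝ A] (𝒜 : ℕ → Submodule ℝ A)
    {r : ℕ} (d : Fin r → ℕ) where
  equiv : A ≃ₐ[ℝ] MvPolynomial (CoordIndex d) ℝ
  mem_piece_iff : ∀ (i : ℕ) (a : A), a ∈ 𝒜 i ↔
    equiv a ∈ MvPolynomial.weightedHomogeneousSubmodule ℝ (coordWeight d) i

/-- `A = ⨁ 𝒜 i` is a graded algebra, isomorphic with `𝒜(ℝ ^ 𝐝)` for some `𝐝`. -/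
def IsGradedPolynomialAlgebra {A : Type*} [CommRing A] [Algebra ℝ A]
    (𝒜 : ℕ → Submodule ℝ A) : Prop :=
  Nonempty (GradedAlgebra 𝒜) ∧
    ∃ (r : ℕ) (d : Fin r → ℕ), Nonempty (GradedCoordinates 𝒜 d)

/-- Graded polynomial algebras. -/
structure GradedPolynomialAlgebra : Type (u + 1) where
  carrier : Type u
  [commRing : CommRing carrier]
  [algebra : Algebra ℝ carrier]
  piece : ℕ → Submodule ℝ carrier
  [graded : GradedAlgebra piece]
  isPolynomial : IsGradedPolynomialAlgebra piece

namespace GradedPolynomialAlgebra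

attribute [instance] commRing algebra graded

/-- Morphisms are homomorphisms of graded (unital) `ℝ`-algebras. -/
instance : Category.{u} GradedPolynomialAlgebra.{u} where
  Hom A B := A.piece →ₐᵍ[ℝ] B.piece
  id A := GradedAlgHom.id ℝ A.piece
  comp f g := GradedAlgHom.comp g f

/-- The graded algebra homomorphism underlying a morphism. -/
abbrev Hom.gr {A B : GradedPolynomialAlgebra.{u}} (φ : A ⟶ B) : A.piece →ₐᵍ[ℝ] B.piece := φ

/-- The set `Hom_gr(A, ℝ[ε])`. -/
def Dual (A : GradedPolynomialAlgebra.{u}) : Type u := A.piece →ₐᵍ[ℝ] epsPiece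

instance (A : GradedPolynomialAlgebra.{u}) : FunLike A.Dual A.carrier (Polynomial ℝ) :=
  inferInstanceAs (FunLike (A.piece →ₐᵍ[ℝ] epsPiece) A.carrier (Polynomial ℝ))

instance (A : GradedPolynomialAlgebra.{u}) : AlgHomClass A.Dual ℝ A.carrier (Polynomial ℝ) :=
  inferInstanceAs (AlgHomClass (A.piece →ₐᵍ[ℝ] epsPiece) ℝ A.carrier (Polynomial ℝ))

/-- The action of `(ℝ, ·)` on `Hom_gr(A, ℝ[ε])`: `(h_t ψ)(a) = h_t (ψ a)`. -/
instance (A : GradedPolynomialAlgebra.{u}) : MulAction ℝ A.Dual where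
  smul t ψ := (epsScaleGr t).comp ψ
  one_smul ψ := DFunLike.ext _ _ fun a => DFunLike.congr_fun epsScale_one (ψ a)
  mul_smul s t ψ := DFunLike.ext _ _ fun a => DFunLike.congr_fun (epsScale_mul s t) (ψ a)

lemma Dual.smul_apply {A : GradedPolynomialAlgebra.{u}} (t : ℝ) (ψ : A.Dual) (a : A.carrier) :
    (t • ψ) a = epsScale t (ψ a) := rfl

lemma Dual.map_mem {A : GradedPolynomialAlgebra.{u}} (ψ : A.Dual) {i : ℕ} {a : A.carrier}
    (ha : a ∈ A.piece i) : ψ a ∈ epsPiece i := GradedRingHom.map_mem ψ.toGradedRingHom ha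

/-- The number `λ_s` with `ψ (y_s) = λ_s ε ^ (weight of s)`, where `(y_s)` are the generators of
`A` given by `c`. -/
def dualCoord {A : GradedPolynomialAlgebra.{u}} {r : ℕ} {d : Fin r → ℕ}
    (c : GradedCoordinates A.piece d) (ψ : A.Dual) (s : CoordIndex d) : ℝ :=
  (ψ (c.equiv.symm (MvPolynomial.X s))).coeff (coordWeight d s)

section coordinates

variable {A : GradedPolynomialAlgebra.{u}} {r : ℕ} {d : Fin r → ℕ}
  (c : GradedCoordinates A.piece d)

lemma dual_apply_gen (ψ : A.Dual) (s : CoordIndex d) :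
    ψ (c.equiv.symm (MvPolynomial.X s)) =
      Polynomial.monomial (coordWeight d s) (dualCoord c ψ s) := by
  have h : c.equiv.symm (MvPolynomial.X s) ∈ A.piece (coordWeight d s) := by
    rw [c.mem_piece_iff, AlgEquiv.apply_symm_apply]
    exact MvPolynomial.isWeightedHomogeneous_X ℝ (coordWeight d) s
  obtain ⟨x, hx⟩ := ψ.map_mem h
  rw [dualCoord, ← hx, Polynomial.coeff_monomial_same]

/-- The algebra homomorphism `y_s ↦ λ_s ε ^ (weight of s)`. -/
def evalHom (d : Fin r → ℕ) (l : CoordIndex d → ℝ) :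
    MvPolynomial (CoordIndex d) ℝ →ₐ[ℝ] Polynomial ℝ :=
  MvPolynomial.aeval fun s => Polynomial.monomial (coordWeight d s) (l s)

lemma dual_apply (ψ : A.Dual) (a : A.carrier) :
    ψ a = evalHom d (dualCoord c ψ) (c.equiv a) := by
  have h : (AlgHomClass.toAlgHom ψ : A.carrier →ₐ[ℝ] Polynomial ℝ).comp (c.equiv.symm : _ →ₐ[ℝ] A.carrier) =
      evalHom d (dualCoord c ψ) := by
    apply MvPolynomial.algHom_ext
    intro s
    simpa [evalHom] using dual_apply_gen c ψ s
  rw [← h]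
  simp

lemma evalHom_mem (l : CoordIndex d → ℝ) {i : ℕ} {p : MvPolynomial (CoordIndex d) ℝ}
    (hp : p ∈ MvPolynomial.weightedHomogeneousSubmodule ℝ (coordWeight d) i) :
    evalHom d l p ∈ epsPiece i := by
  rw [MvPolynomial.mem_weightedHomogeneousSubmodule] at hp
  rw [evalHom, MvPolynomial.aeval_def, MvPolynomial.eval₂_eq]
  refine Submodule.sum_mem _ fun m hm => ?_
  have hw := hp (MvPolynomial.mem_support_iff.1 hm)
  have key : ∏ s ∈ m.support, Polynomial.monomial (coordWeight d s) (l s) ^ m s ∈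
      epsPiece (∑ s ∈ m.support, m s • coordWeight d s) :=
    SetLike.prod_mem_graded _ _ _ fun s _ => SetLike.pow_mem_graded _ ⟨l s, rfl⟩
  rw [← Algebra.smul_def]
  refine Submodule.smul_mem _ _ ?_
  rw [← hw, Finsupp.weight_apply]
  exact key

/-- The graded algebra homomorphism with coordinates `l`. -/
def dualOfCoord (l : CoordIndex d → ℝ) : A.Dual :=
  (⟨(evalHom d l).comp c.equiv.toAlgHom, fun {i} {a} ha =>
    evalHom_mem l ((c.mem_piece_iff i a).1 ha)⟩ : A.piece →ₐᵍ[ℝ] epsPiece)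

/-- The bijection `Hom_gr(A, ℝ[ε]) ≃ ℝ ^ 𝐝` given by graded coordinates. -/
def dualCoordEquiv : A.Dual ≃ (CoordIndex d → ℝ) where
  toFun := dualCoord c
  invFun := dualOfCoord c
  left_inv ψ := DFunLike.ext _ _ fun a => (dual_apply c ψ a).symm
  right_inv l := by
    funext s
    change (evalHom d l (c.equiv (c.equiv.symm (MvPolynomial.X s)))).coeff _ = _
    rw [AlgEquiv.apply_symm_apply, evalHom, MvPolynomial.aeval_X, Polynomial.coeff_monomial_same]

lemma contDiff_coeff_evalHom (p : MvPolynomial (CoordIndex d) ℝ) (j : ℕ) :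
    ContDiff ℝ ∞ fun l : CoordIndex d → ℝ => (evalHom d l p).coeff j := by
  induction p using MvPolynomial.induction_on generalizing j with
  | C x => simpa [evalHom] using contDiff_const
  | add p q hp hq => simpa using (hp j).add (hq j)
  | mul_X p s hp =>
    simp only [map_mul, Polynomial.coeff_mul]
    refine ContDiff.sum fun x _ => (hp x.1).mul ?_
    simp only [evalHom, MvPolynomial.aeval_X, Polynomial.coeff_monomial]
    split_ifs
    · exact contDiff_apply ℝ ℝ s
    · exact contDiff_const

end coordinates

/-! The smooth structure of `Hom_gr(A, ℝ[ε])` is transported from `ℝ ^ 𝐝` along some graded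
coordinates; it does not depend on which ones. -/

/-- Some `r`, for which `A` has graded coordinates. -/
def coordLen (A : GradedPolynomialAlgebra.{u}) : ℕ := A.isPolynomial.2.choose

/-- Some `𝐝 = (d_1, …, d_r)` for which `A ≅ 𝒜(ℝ ^ 𝐝)`. -/
def coordDim (A : GradedPolynomialAlgebra.{u}) : Fin A.coordLen → ℕ :=
  A.isPolynomial.2.choose_spec.choose

/-- Some graded coordinates. -/
def someCoord (A : GradedPolynomialAlgebra.{u}) : GradedCoordinates A.piece A.coordDim :=
  A.isPolynomial.2.choose_spec.choose_spec.some

/-- The dimension of `Hom_gr(A, ℝ[ε])`. -/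
def dualDim (A : GradedPolynomialAlgebra.{u}) : ℕ := ∑ i, A.coordDim i

/-- The coordinates numbered by `0, …, dualDim - 1`. -/
def coordNum (A : GradedPolynomialAlgebra.{u}) : CoordIndex A.coordDim ≃ Fin A.dualDim :=
  finSigmaFinEquiv

/-- The global chart of `Hom_gr(A, ℝ[ε])`. -/
def dualChart (A : GradedPolynomialAlgebra.{u}) :
    A.Dual ≃ EuclideanSpace ℝ (Fin A.dualDim) :=
  ((dualCoordEquiv A.someCoord).trans
    (Equiv.arrowCongr A.coordNum (Equiv.refl ℝ))).trans
    (WithLp.equiv 2 (Fin A.dualDim → ℝ)).symm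

instance (A : GradedPolynomialAlgebra.{u}) : TopologicalSpace A.Dual :=
  TopologicalSpace.induced A.dualChart inferInstance

/-- The global chart as a homeomorphism. -/
def dualHomeo (A : GradedPolynomialAlgebra.{u}) :
    A.Dual ≃ₜ EuclideanSpace ℝ (Fin A.dualDim) :=
  A.dualChart.toHomeomorphOfIsInducing ⟨rfl⟩

instance (A : GradedPolynomialAlgebra.{u}) : T2Space A.Dual :=
  A.dualHomeo.symm.t2Space

instance (A : GradedPolynomialAlgebra.{u}) : SecondCountableTopology A.Dual :=
  A.dualHomeo.secondCountableTopology

instance (A : GradedPolynomialAlgebra.{u}) : Nonempty A.Dual :=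
  ⟨A.dualChart.symm 0⟩

instance (A : GradedPolynomialAlgebra.{u}) :
    ChartedSpace (EuclideanSpace ℝ (Fin A.dualDim)) A.Dual :=
  A.dualHomeo.isOpenEmbedding.singletonChartedSpace

instance (A : GradedPolynomialAlgebra.{u}) : IsManifold (𝓡 A.dualDim) ∞ A.Dual :=
  A.dualHomeo.isOpenEmbedding.isManifold_singleton

lemma contMDiff_dualHomeo (A : GradedPolynomialAlgebra.{u}) :
    ContMDiff (𝓡 A.dualDim) (𝓡 A.dualDim) ∞ A.dualHomeo :=
  contMDiff_isOpenEmbedding A.dualHomeo.isOpenEmbedding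

lemma dualHomeo_apply (A : GradedPolynomialAlgebra.{u}) (ψ : A.Dual) (i : Fin A.dualDim) :
    A.dualHomeo ψ i = dualCoord A.someCoord ψ (A.coordNum.symm i) := rfl

lemma contMDiff_coeff (A : GradedPolynomialAlgebra.{u}) (a : A.carrier) (j : ℕ) :
    ContMDiff (𝓡 A.dualDim) 𝓘(ℝ, ℝ) ∞ fun ψ : A.Dual => (ψ a).coeff j := by
  have h : (fun ψ : A.Dual => (ψ a).coeff j) =
      (fun x : EuclideanSpace ℝ (Fin A.dualDim) =>
        (evalHom A.coordDim (fun s => x (A.coordNum s))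
          (A.someCoord.equiv a)).coeff j) ∘ A.dualHomeo := by
    funext ψ
    rw [Function.comp_apply, dual_apply A.someCoord ψ a]
    congr 3
    funext s
    rw [dualHomeo_apply, Equiv.symm_apply_apply]
  rw [h]
  refine ContMDiff.comp (I' := 𝓡 A.dualDim) (ContDiff.contMDiff ?_) A.contMDiff_dualHomeo
  refine (contDiff_coeff_evalHom (d := A.coordDim) (A.someCoord.equiv a) j).comp
    (contDiff_pi.2 fun s => ?_)
  exact (EuclideanSpace.proj (𝕜 := ℝ) (A.coordNum s)).contDiff

lemma contMDiff_into_dual {E H M : Type*} [NormedAddCommGroup E] [NormedSpace ℝ E]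
    [TopologicalSpace H] {I : ModelWithCorners ℝ E H} [TopologicalSpace M] [ChartedSpace H M]
    (A : GradedPolynomialAlgebra.{u}) {f : M → A.Dual}
    (hf : ∀ s, ContMDiff I 𝓘(ℝ, ℝ) ∞ fun x => dualCoord A.someCoord (f x) s) :
    ContMDiff I (𝓡 A.dualDim) ∞ f := by
  refine ContMDiff.of_comp_isOpenEmbedding A.dualHomeo.isOpenEmbedding ?_
  have h : ContMDiff I 𝓘(ℝ, Fin A.dualDim → ℝ) ∞ fun x => fun i : Fin A.dualDim =>
      dualCoord A.someCoord (f x) (A.coordNum.symm i) :=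
    contMDiff_pi_space.2 fun i => hf _
  exact (EuclideanSpace.equiv (Fin A.dualDim) ℝ).symm.contDiff.contMDiff.comp h

lemma dualCoord_smul {A : GradedPolynomialAlgebra.{u}} {r : ℕ} {d : Fin r → ℕ}
    (c : GradedCoordinates A.piece d) (t : ℝ) (ψ : A.Dual) (s : CoordIndex d) :
    dualCoord c (t • ψ) s = t ^ coordWeight d s * dualCoord c ψ s := by
  rw [dualCoord, Dual.smul_apply, dual_apply_gen c ψ s, epsScale_monomial,
    Polynomial.coeff_monomial_same]

instance (A : GradedPolynomialAlgebra.{u}) :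
    ContMDiffSMul 𝓘(ℝ, ℝ) (𝓡 A.dualDim) ∞ ℝ A.Dual where
  contMDiff_smul := by
    refine A.contMDiff_into_dual fun s => ?_
    simp only [dualCoord_smul]
    exact (contMDiff_fst.pow _).mul ((A.contMDiff_coeff _ _).comp contMDiff_snd)

/-- The graded space `Hom_gr(A, ℝ[ε])`. -/
def dualSpace (A : GradedPolynomialAlgebra.{u}) : GradedSpace.{u} where
  carrier := A.Dual
  dim := A.dualDim
  zero_smul_const := ⟨(dualCoordEquiv A.someCoord).symm 0, fun ψ => by
    rw [Equiv.eq_symm_apply]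
    funext s
    change dualCoord A.someCoord ((0 : ℝ) • (ψ : A.Dual)) s = 0
    simp [dualCoord_smul, coordWeight]⟩

/-- The dual morphism `ζ ↦ ζ ∘ φ`. -/
def dualSpaceMap {A B : GradedPolynomialAlgebra.{u}} (φ : A ⟶ B) :
    B.dualSpace ⟶ A.dualSpace where
  toFun := fun ζ : B.Dual => (GradedAlgHom.comp ζ (Hom.gr φ) : A.piece →ₐᵍ[ℝ] epsPiece)
  smooth := A.contMDiff_into_dual fun _ => B.contMDiff_coeff _ _
  map_smul _ _ := rfl

end GradedPolynomialAlgebra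

/-! ## The duality functors -/

/-- The contravariant functor `V ↦ Hom_𝔾(V, ℝ[ε])`, `f ↦ (α ↦ α ∘ f)`, once it is known to take
values in graded polynomial algebras. -/
def gDualFunctor
    (h : ∀ V : GradedSpace.{u}, IsGradedPolynomialAlgebra V.dualPiece) :
    GradedSpace.{u}ᵒᵖ ⥤ GradedPolynomialAlgebra.{u} where
  obj V :=
    letI := (h V.unop).1.some
    { carrier := V.unop.dual
      piece := V.unop.dualPiece
      isPolynomial := h V.unop }
  map {V W} f :=
    letI := (h V.unop).1.some
    letI := (h W.unop).1.some
    (⟨GradedSpace.dualMap f.unop, fun hα _ => hα _⟩ :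
      V.unop.dualPiece →ₐᵍ[ℝ] W.unop.dualPiece)
  map_id _ := rfl
  map_comp _ _ := rfl

/-- The evaluation map `ev_V : V → Hom_gr(Hom_𝔾(V, ℝ[ε]), ℝ[ε])`, `v ↦ (α ↦ α v)`. -/
def evSpace (h : ∀ V : GradedSpace.{u}, IsGradedPolynomialAlgebra V.dualPiece)
    (V : GradedSpace.{u}) (v : V.carrier) : ((gDualFunctor h).obj (op V)).Dual :=
  letI := (h V).1.some
  (⟨(Pi.evalAlgHom ℝ (fun _ : V.carrier => Polynomial ℝ) v).comp V.dual.val, fun hα => hα v⟩ :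
    V.dualPiece →ₐᵍ[ℝ] epsPiece)

/-- The evaluation map `ev_A : A → Hom_𝔾(Hom_gr(A, ℝ[ε]), ℝ[ε])`, `a ↦ (ψ ↦ ψ a)`. -/
def evAlg (A : GradedPolynomialAlgebra.{u}) (a : A.carrier) : A.dualSpace.dual :=
  ⟨fun ψ : A.Dual => ψ a,
    (A.dualSpace.smoothToEps_iff _).2 fun j => A.contMDiff_coeff a j, fun _ _ => rfl⟩

/-- The contravariant functor `A ↦ Hom_gr(A, ℝ[ε])`, `φ ↦ (ζ ↦ ζ ∘ φ)`. -/
def algDualFunctor : GradedPolynomialAlgebra.{u}ᵒᵖ ⥤ GradedSpace.{u} where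
  obj A := A.unop.dualSpace
  map φ := GradedPolynomialAlgebra.dualSpaceMap φ.unop
  map_id _ := rfl
  map_comp _ _ := rfl

end

noncomputable section

open Filter Topology

/-! ## Smooth weighted-homogeneous functions are polynomials -/

section weighted

variable {ι : Type*}

/-- The weighted dilation `x ↦ (t ^ w_s x_s)_s` of `ℝ ^ ι`, as a linear map. -/
def dilation (w : ι → ℕ) (t : ℝ) : (ι → ℝ) →L[ℝ] (ι → ℝ) :=
  ContinuousLinearMap.pi fun s => t ^ w s • ContinuousLinearMap.proj s

@[simp]
lemma dilation_apply (w : ι → ℕ) (t : ℝ) (x : ι → ℝ) (s : ι) :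
    dilation w t x s = t ^ w s * x s := rfl

lemma dilation_zero {w : ι → ℕ} (hw : ∀ s, 0 < w s) (x : ι → ℝ) : dilation w 0 x = 0 := by
  funext s
  simp [(hw s).ne']

lemma dilation_single [DecidableEq ι] (w : ι → ℕ) (t : ℝ) (j : ι) :
    dilation w t (Pi.single j 1) = t ^ w j • Pi.single j (1 : ℝ) := by
  funext s
  by_cases h : s = j
  · subst h; simp
  · simp [h]

lemma continuous_dilation (w : ι → ℕ) (x : ι → ℝ) : Continuous fun t => dilation w t x :=
  continuous_pi fun s => (continuous_pow (w s)).mul continuous_const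

lemma eq_of_eqOn_ne_zero {f g : ℝ → ℝ} (hf : Continuous f) (hg : Continuous g)
    (h : ∀ t, t ≠ 0 → f t = g t) : f = g :=
  hf.ext_on (dense_compl_singleton 0) hg fun t ht => h t ht

variable [Fintype ι] {w : ι → ℕ} {i : ℕ} {F : (ι → ℝ) → ℝ}

lemma fderiv_homogeneous [DecidableEq ι] (hF : ContDiff ℝ ∞ F)
    (hom : ∀ t x, F (dilation w t x) = t ^ i * F x) (t : ℝ) (x : ι → ℝ) (j : ι) :
    t ^ w j * fderiv ℝ F (dilation w t x) (Pi.single j 1) =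
      t ^ i * fderiv ℝ F x (Pi.single j 1) := by
  have hd : Differentiable ℝ F := hF.differentiable (by simp)
  have h1 : HasFDerivAt (fun y => F (dilation w t y))
      ((fderiv ℝ F (dilation w t x)).comp (dilation w t)) x :=
    (hd _).hasFDerivAt.comp x (dilation w t).hasFDerivAt
  have h2 : HasFDerivAt (fun y => F (dilation w t y)) (t ^ i • fderiv ℝ F x) x := by
    simp only [hom]
    exact (hd x).hasFDerivAt.const_mul _
  have h3 := DFunLike.congr_fun (h1.unique h2) (Pi.single j 1)
  simpa [dilation_single] using h3

lemma euler_homogeneous [DecidableEq ι] (hF : ContDiff ℝ ∞ F)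
    (hom : ∀ t x, F (dilation w t x) = t ^ i * F x) (x : ι → ℝ) :
    ∑ j, w j * x j * fderiv ℝ F x (Pi.single j 1) = i * F x := by
  have hd : Differentiable ℝ F := hF.differentiable (by simp)
  have h0 : HasDerivAt (fun t => dilation w t x) (fun s => w s * x s) 1 := by
    rw [hasDerivAt_pi]
    intro s
    simpa using (hasDerivAt_pow (w s) (1 : ℝ)).mul_const (x s)
  have hx : dilation w 1 x = x := by funext s; simp
  have h1 := ((hd _).hasFDerivAt (x := dilation w 1 x)).comp_hasDerivAt (1 : ℝ) h0
  have h2 : HasDerivAt (F ∘ fun t => dilation w t x) (i * F x) 1 := by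
    have : (F ∘ fun t => dilation w t x) = fun t => t ^ i * F x := funext fun t => hom t x
    rw [this]
    simpa using (hasDerivAt_pow i (1 : ℝ)).mul_const (F x)
  rw [← h1.unique h2, hx]
  conv_rhs => rw [pi_eq_sum_univ' (fun s => (w s : ℝ) * x s)]
  simp [map_sum, map_smul, Pi.single]

/-- A smooth function on `ℝ ^ ι`, homogeneous of degree `i` for positive weights, is a weighted
homogeneous polynomial of degree `i`. -/
theorem exists_isWeightedHomogeneous_eval_eq (hw : ∀ s, 0 < w s) (hF : ContDiff ℝ ∞ F)
    (hom : ∀ t x, F (dilation w t x) = t ^ i * F x) :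
    ∃ p : MvPolynomial ι ℝ, p.IsWeightedHomogeneous w i ∧ ∀ x, MvPolynomial.eval x p = F x := by
  classical
  induction i using Nat.strong_induction_on generalizing F with
  | _ i ih =>
  rcases Nat.eq_zero_or_pos i with rfl | hi
  · refine ⟨MvPolynomial.C (F 0), MvPolynomial.isWeightedHomogeneous_C _ _, fun x => ?_⟩
    have := hom 0 x
    rw [dilation_zero hw] at this
    simpa using this
  have hcont (j : ι) : Continuous fun x => fderiv ℝ F x (Pi.single j 1) :=
    (hF.continuous_fderiv (by simp)).clm_apply continuous_const
  have hpart (j : ι) : ∃ p : MvPolynomial ι ℝ,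
      (MvPolynomial.X j * p).IsWeightedHomogeneous w i ∧
        ∀ x, MvPolynomial.eval x p = fderiv ℝ F x (Pi.single j 1) := by
    rcases le_or_gt (w j) i with hj | hj
    · obtain ⟨p, hp, hpe⟩ := ih (i - w j) (Nat.sub_lt hi (hw j))
        (F := fun x => fderiv ℝ F x (Pi.single j 1))
        ((hF.fderiv_right (m := ∞) (by simp)).clm_apply contDiff_const) (by
          intro t x
          refine congrFun (eq_of_eqOn_ne_zero
            (f := fun t => fderiv ℝ F (dilation w t x) (Pi.single j 1))
            (g := fun t => t ^ (i - w j) * fderiv ℝ F x (Pi.single j 1))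
            ((hcont j).comp (continuous_dilation w x)) (by fun_prop) fun t ht => ?_) t
          have h := fderiv_homogeneous hF hom t x j
          apply mul_left_cancel₀ (pow_ne_zero (w j) ht)
          rw [h, ← mul_assoc, ← pow_add, Nat.add_sub_cancel' hj])
      refine ⟨p, ?_, hpe⟩
      have := (MvPolynomial.isWeightedHomogeneous_X ℝ w j).mul hp
      rwa [Nat.add_sub_cancel' hj] at this
    · refine ⟨0, by simpa using MvPolynomial.isWeightedHomogeneous_zero ℝ w i, fun x => ?_⟩
      have h := congrFun (eq_of_eqOn_ne_zero
        (f := fun t => t ^ (w j - i) * fderiv ℝ F (dilation w t x) (Pi.single j 1))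
        (g := fun _ => fderiv ℝ F x (Pi.single j 1))
        ((continuous_pow _).mul ((hcont j).comp (continuous_dilation w x))) continuous_const
        fun t ht => ?_) 0
      · simpa [(Nat.sub_pos_of_lt hj).ne'] using h
      · have h := fderiv_homogeneous hF hom t x j
        apply mul_left_cancel₀ (pow_ne_zero i ht)
        rw [← h, ← mul_assoc, ← pow_add, Nat.add_sub_cancel' hj.le]
  choose p hp hpe using hpart
  refine ⟨∑ j, MvPolynomial.C ((i : ℝ)⁻¹ * w j) * (MvPolynomial.X j * p j),
    MvPolynomial.IsWeightedHomogeneous.sum _ _ _ fun j _ => (hp j).C_mul _, fun x => ?_⟩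
  have hi' : (i : ℝ) ≠ 0 := by exact_mod_cast hi.ne'
  have := euler_homogeneous hF hom x
  rw [← inv_mul_eq_iff_eq_mul₀ hi', Finset.mul_sum] at this
  rw [← this]
  simp [hpe, mul_assoc]

end weighted

/-! ## Linear representations of `(ℝ, ·)` and parametric derivatives -/

section linear

variable {E F : Type*} [NormedAddCommGroup E] [NormedSpace ℝ E]
  [NormedAddCommGroup F] [NormedSpace ℝ F]

lemma ContinuousLinearMap.iteratedDeriv_comp_left (Φ : E →L[ℝ] F) {f : ℝ → E}
    (hf : ContDiff ℝ ∞ f) (k : ℕ) (t : ℝ) :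
    iteratedDeriv k (fun s => Φ (f s)) t = Φ (iteratedDeriv k f t) := by
  rw [iteratedDeriv, iteratedDeriv]
  have := Φ.iteratedFDeriv_comp_left (f := f) (x := t) (hf.contDiffAt.of_le (mod_cast le_top))
    (i := k) le_rfl
  change iteratedFDeriv ℝ k (Φ ∘ f) t _ = _
  rw [this]
  rfl

lemma exists_norm_le_pow_of_flat {g : ℝ → E} (hg : ContDiff ℝ ∞ g)
    (h0 : ∀ k, iteratedDeriv k g 0 = 0) (n : ℕ) :
    ∃ C : ℝ, ∀ t ∈ Set.Icc (0 : ℝ) 1, ‖g t‖ ≤ C * t ^ (n + 1) := by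
  obtain ⟨C, hC⟩ := exists_taylor_mean_remainder_bound (f := g) (n := n) zero_le_one
    (hg.contDiffOn.of_le (mod_cast le_top))
  have hT (t : ℝ) (m : ℕ) : taylorWithinEval g m (Set.Icc 0 1) 0 t = 0 := by
    have hd (k : ℕ) : iteratedDerivWithin k g (Set.Icc 0 1) 0 = 0 := by
      rw [iteratedDerivWithin_eq_iteratedDeriv (uniqueDiffOn_Icc zero_lt_one)
        (hg.contDiffAt.of_le (mod_cast le_top)) ⟨le_rfl, zero_le_one⟩, h0]
    induction m with
    | zero => simpa using h0 0
    | succ m ih => rw [taylorWithinEval_succ, ih, hd, smul_zero, add_zero]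
  exact ⟨C, fun t ht => by simpa [hT] using hC t ht⟩

/-- A smooth linear representation of the monoid `(ℝ, ·)` is determined by its jet at `0`: no
nonzero vector has an orbit which is flat at `0`. -/
theorem eq_zero_of_flat_orbit {L : ℝ → E →L[ℝ] E} (hL : ContDiff ℝ ∞ L)
    (h1 : L 1 = ContinuousLinearMap.id ℝ E) (hmul : ∀ s t, L (s * t) = (L s).comp (L t))
    {x : E} (hx : ∀ k, iteratedDeriv k L 0 x = 0) : x = 0 := by
  have hg : ContDiff ℝ ∞ fun t => L t x := hL.clm_apply contDiff_const
  have h0 (k : ℕ) : iteratedDeriv k (fun t => L t x) 0 = 0 := by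
    rw [← hx k]
    exact (ContinuousLinearMap.apply ℝ E x).iteratedDeriv_comp_left hL k 0
  obtain ⟨N, hN⟩ := pow_unbounded_of_one_lt ‖L 2‖ (one_lt_two (α := ℝ))
  obtain ⟨C, hC⟩ := exists_norm_le_pow_of_flat hg h0 N
  have hpow (m : ℕ) : ‖L (2 ^ m)‖ ≤ max 1 ‖L 2‖ ^ m := by
    induction m with
    | zero => simpa [h1] using ContinuousLinearMap.norm_id_le
    | succ m ih =>
      rw [pow_succ, hmul, pow_succ]
      exact (ContinuousLinearMap.opNorm_comp_le _ _).trans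
        (mul_le_mul ih (le_max_right _ _) (norm_nonneg _) (by positivity))
  have hlt : max 1 ‖L 2‖ / 2 ^ (N + 1) < 1 := by
    rw [div_lt_one (by positivity)]
    refine max_lt (one_lt_pow₀ one_lt_two (by simp)) (hN.trans ?_)
    exact pow_lt_pow_right₀ one_lt_two (Nat.lt_succ_self N)
  have hbound (m : ℕ) : ‖x‖ ≤ C * (max 1 ‖L 2‖ / 2 ^ (N + 1)) ^ m := by
    have hxm : x = L (2 ^ m) (L ((2 : ℝ)⁻¹ ^ m) x) := by
      rw [← ContinuousLinearMap.comp_apply, ← hmul, ← mul_pow,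
        mul_inv_cancel₀ two_ne_zero, one_pow, h1, ContinuousLinearMap.id_apply]
    have hb := hC ((2 : ℝ)⁻¹ ^ m) ⟨by positivity, pow_le_one₀ (by positivity) (by norm_num)⟩
    calc ‖x‖ = ‖L (2 ^ m) (L ((2 : ℝ)⁻¹ ^ m) x)‖ := by rw [← hxm]
      _ ≤ ‖L (2 ^ m)‖ * ‖L ((2 : ℝ)⁻¹ ^ m) x‖ := ContinuousLinearMap.le_opNorm _ _
      _ ≤ max 1 ‖L 2‖ ^ m * (C * ((2 : ℝ)⁻¹ ^ m) ^ (N + 1)) :=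
        mul_le_mul (hpow m) hb (norm_nonneg _) (by positivity)
      _ = C * (max 1 ‖L 2‖ / 2 ^ (N + 1)) ^ m := by
        rw [div_pow, ← pow_mul, ← pow_mul, inv_pow, mul_comm m]
        ring
  have hlim := (tendsto_pow_atTop_nhds_zero_of_lt_one (by positivity) hlt).const_mul C
  rw [mul_zero] at hlim
  exact norm_le_zero_iff.1 (ge_of_tendsto' hlim hbound)

/-- Iterated partial derivatives in the first variable. -/
def partialDeriv (H : ℝ × E → F) (k : ℕ) (p : ℝ × E) : F :=
  iteratedDeriv k (fun s => H (s, p.2)) p.1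

lemma partialDeriv_succ {H : ℝ × E → F} {k : ℕ} (h : ContDiff ℝ ∞ (partialDeriv H k))
    (p : ℝ × E) : partialDeriv H (k + 1) p = fderiv ℝ (partialDeriv H k) p (1, 0) := by
  rw [partialDeriv, iteratedDeriv_succ]
  have h1 : HasDerivAt (fun s : ℝ => (s, p.2)) (1, 0) p.1 :=
    (hasDerivAt_id _).prodMk (hasDerivAt_const _ _)
  have h2 := ((h.differentiable (by simp)) p).hasFDerivAt.comp_hasDerivAt p.1 h1
  exact h2.deriv

lemma contDiff_partialDeriv {H : ℝ × E → F} (hH : ContDiff ℝ ∞ H) (k : ℕ) :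
    ContDiff ℝ ∞ (partialDeriv H k) := by
  induction k with
  | zero =>
    have : partialDeriv H 0 = H := funext fun p => by simp [partialDeriv]
    rwa [this]
  | succ k ih =>
    rw [funext (partialDeriv_succ ih)]
    exact (ih.fderiv_right (m := ∞) (by simp)).clm_apply contDiff_const

lemma fderiv_prodMk_right {H : ℝ × E → F} (hH : ContDiff ℝ ∞ H) (t : ℝ) (x : E) :
    fderiv ℝ (fun y => H (t, y)) x =
      (fderiv ℝ H (t, x)).comp (ContinuousLinearMap.inr ℝ ℝ E) :=
  (((hH.differentiable (by simp)) (t, x)).hasFDerivAt.comp x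
    (hasFDerivAt_prodMk_right t x)).fderiv

lemma contDiff_fderiv_prodMk_right {H : ℝ × E → F} (hH : ContDiff ℝ ∞ H) (x : E) :
    ContDiff ℝ ∞ fun t => fderiv ℝ (fun y => H (t, y)) x := by
  simp only [fderiv_prodMk_right hH]
  exact ((hH.fderiv_right (m := ∞) (by simp)).comp
    (contDiff_id.prodMk contDiff_const)).clm_comp contDiff_const

/-- The derivatives in the first variable commute with the differential in the second one. -/
lemma fderiv_partialDeriv {H : ℝ × E → F} (hH : ContDiff ℝ ∞ H) (k : ℕ) (t : ℝ) (x : E) :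
    fderiv ℝ (fun y => partialDeriv H k (t, y)) x =
      iteratedDeriv k (fun s => fderiv ℝ (fun y => H (s, y)) x) t := by
  induction k generalizing t with
  | zero => simp [partialDeriv]
  | succ k ih =>
    set G := partialDeriv H k with hG
    have hGs : ContDiff ℝ ∞ G := contDiff_partialDeriv hH k
    have hD : ContDiff ℝ ∞ (fderiv ℝ G) := hGs.fderiv_right (by simp)
    have hDd := (hD.differentiable (by simp)) (t, x)
    rw [iteratedDeriv_succ, ← funext fun s => ih s]
    have h1 : HasDerivAt (fun s : ℝ => (s, x)) (1, 0) t :=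
      (hasDerivAt_id _).prodMk (hasDerivAt_const _ _)
    have h2 : HasDerivAt (fun s => fderiv ℝ G (s, x)) (fderiv ℝ (fderiv ℝ G) (t, x) (1, 0)) t :=
      hDd.hasFDerivAt.comp_hasDerivAt t h1
    have h3 : HasDerivAt (fun s => fderiv ℝ (fun y => G (s, y)) x)
        ((fderiv ℝ (fderiv ℝ G) (t, x) (1, 0)).comp (ContinuousLinearMap.inr ℝ ℝ E)) t := by
      simp only [fderiv_prodMk_right hGs]
      exact ((ContinuousLinearMap.compL ℝ E (ℝ × E) F).flip
        (ContinuousLinearMap.inr ℝ ℝ E)).hasFDerivAt.comp_hasDerivAt t h2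
    rw [h3.deriv]
    have h4 : HasFDerivAt (fun y => partialDeriv H (k + 1) (t, y))
        (((fderiv ℝ (fderiv ℝ G) (t, x)).comp (ContinuousLinearMap.inr ℝ ℝ E)).flip (1, 0)) x := by
      simp only [partialDeriv_succ hGs]
      have h5 : HasFDerivAt (fun y => fderiv ℝ G (t, y))
          ((fderiv ℝ (fderiv ℝ G) (t, x)).comp (ContinuousLinearMap.inr ℝ ℝ E)) x :=
        hDd.hasFDerivAt.comp x (hasFDerivAt_prodMk_right t x)
      exact (ContinuousLinearMap.apply ℝ F ((1 : ℝ), (0 : E))).hasFDerivAt.comp x h5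
    rw [h4.fderiv]
    ext y
    exact hGs.contDiffAt.isSymmSndFDerivAt
      (by simpa using WithTop.coe_le_coe.2 (le_top (a := (2 : ℕ∞)))) (0, y) (1, 0)

end linear

/-- From a family of linear forms without common kernel one can choose linear coordinates. -/
theorem exists_linearEquiv_of_separating {E : Type*} [AddCommGroup E] [Module ℝ E]
    [FiniteDimensional ℝ E] {J : Type} (φ : J → Module.Dual ℝ E)
    (sep : ∀ x, (∀ j, φ j x = 0) → x = 0) :
    ∃ (κ : Type) (_ : Fintype κ) (a : κ → J) (e : E ≃ₗ[ℝ] (κ → ℝ)),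
      (∀ x i, e x i = φ (a i) x) ∧ ∀ i, φ (a i) ≠ 0 := by
  obtain ⟨κ, a, -, hspan, hli⟩ := exists_linearIndependent' ℝ φ
  have : Fintype κ := @Fintype.ofFinite κ hli.finite
  have htop : Submodule.span ℝ (Set.range φ) = ⊤ := by
    rw [← Subspace.dualCoannihilator_dualAnnihilator_eq (W := Submodule.span ℝ (Set.range φ)),
      ← Submodule.dualAnnihilator_bot]
    congr 1
    rw [eq_bot_iff]
    intro x hx
    rw [Submodule.mem_dualCoannihilator] at hx
    exact sep x fun j => hx _ (Submodule.subset_span ⟨j, rfl⟩)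
  rw [htop] at hspan
  let f : E →ₗ[ℝ] (κ → ℝ) := LinearMap.pi (φ ∘ a)
  have hinj : Function.Injective f := by
    rw [injective_iff_map_eq_zero]
    intro x hx
    have hle : Submodule.span ℝ (Set.range (φ ∘ a)) ≤
        LinearMap.ker (Module.Dual.eval ℝ E x) := by
      rw [Submodule.span_le]
      rintro _ ⟨i, rfl⟩
      exact congrFun hx i
    rw [hspan] at hle
    exact (Module.forall_dual_apply_eq_zero_iff ℝ x).1 fun g => hle (Submodule.mem_top (x := g))
  have hcard : Module.finrank ℝ E = Module.finrank ℝ (κ → ℝ) := by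
    rw [Module.finrank_fintype_fun_eq_card, ← Subspace.dual_finrank_eq (K := ℝ) (V := E)]
    exact Module.finrank_eq_card_basis (Module.Basis.mk hli hspan.ge)
  exact ⟨κ, this, a, LinearEquiv.ofInjectiveOfFinrankEq f hinj hcard, fun _ _ => rfl,
    fun i => hli.ne_zero i⟩

/-! ## Smooth maps near a point of a manifold -/

section manifold

variable {E H M F : Type*} [NormedAddCommGroup E] [NormedSpace ℝ E] [TopologicalSpace H]
  {I : ModelWithCorners ℝ E H} [TopologicalSpace M] [ChartedSpace H M] [IsManifold I ∞ M]
  [NormedAddCommGroup F] [NormedSpace ℝ F]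

lemma contMDiff_deriv_left {G : ℝ × M → F}
    (hG : ContMDiff (𝓘(ℝ, ℝ).prod I) 𝓘(ℝ, F) ∞ G) :
    ContMDiff (𝓘(ℝ, ℝ).prod I) 𝓘(ℝ, F) ∞ fun p : ℝ × M => deriv (fun s => G (s, p.2)) p.1 := by
  intro p₀
  have h := ContMDiffAt.mfderiv (I := 𝓘(ℝ, ℝ)) (I' := 𝓘(ℝ, F)) (J := 𝓘(ℝ, ℝ).prod I)
    (x₀ := p₀) (m := ∞) (n := ∞) (fun (p : ℝ × M) (s : ℝ) => G (s, p.2)) (fun p : ℝ × M => p.1)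
    (hG.comp (contMDiff_snd.prodMk (contMDiff_snd.comp contMDiff_fst))).contMDiffAt
    contMDiff_fst.contMDiffAt (by simp)
  have hc := inTangentCoordinates_model_space (I := 𝓘(ℝ, ℝ)) (I' := 𝓘(ℝ, F))
    (fun p : ℝ × M => p.1) (fun p : ℝ × M => G (p.1, p.2))
    (fun p : ℝ × M => mfderiv 𝓘(ℝ, ℝ) 𝓘(ℝ, F) (fun s => G (s, p.2)) p.1) p₀
  have h := h.congr_of_eventuallyEq (.of_eq hc.symm)
  simp only [mfderiv_eq_fderiv] at h
  exact ContMDiffAt.clm_apply (F₁ := ℝ) (F₂ := F) h (contMDiffAt_const (c := (1 : ℝ)))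

lemma exists_smooth_localInverse [T2Space M] [FiniteDimensional ℝ E] [I.Boundaryless] (o : M) :
    ∃ (f : M → E) (g : E → M), ContMDiff I 𝓘(ℝ, E) ∞ f ∧ ContMDiff 𝓘(ℝ, E) I ∞ g ∧
      f o = 0 ∧ g 0 = o ∧ (∀ᶠ x in 𝓝 0, f (g x) = x) ∧ ∀ᶠ v in 𝓝 o, g (f v) = v := by
  let φ := extChartAt I o
  have htar : φ.target ∈ 𝓝 (φ o) := extChartAt_target_mem_nhds o
  obtain ⟨r, hr, hball⟩ := Metric.mem_nhds_iff.1 htar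
  let β : ContDiffBump (0 : E) := ⟨r / 2, r, by positivity, by linarith⟩
  obtain ⟨ρ⟩ : Nonempty (SmoothBumpFunction I o) := inferInstance
  let f : M → E := fun v => ρ v • (φ v - φ o)
  let g : E → M := fun x => φ.symm (φ o + β x • x)
  have hfs : ContMDiff I 𝓘(ℝ, E) ∞ f :=
    ρ.contMDiff_smul (contMDiffOn_extChartAt.sub contMDiffOn_const)
  have hmem (x : E) : φ o + β x • x ∈ φ.target := by
    apply hball
    rw [Metric.mem_ball, dist_eq_norm, add_sub_cancel_left, norm_smul,
      Real.norm_of_nonneg β.nonneg]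
    by_cases hx : x ∈ Metric.ball (0 : E) r
    · rw [mem_ball_zero_iff] at hx
      exact (mul_le_of_le_one_left (norm_nonneg _) β.le_one).trans_lt hx
    · have : β x = 0 := by
        rw [← Function.notMem_support, β.support_eq]
        exact hx
      simpa [this] using hr
  have hgs : ContMDiff 𝓘(ℝ, E) I ∞ g := by
    refine (contMDiffOn_extChartAt_symm o).comp_contMDiff (ContDiff.contMDiff ?_) hmem
    exact contDiff_const.add (β.contDiff.smul contDiff_id)
  have hf0 : f o = 0 := by simp [f]
  have hg0 : g 0 = o := by simp [g, φ]
  have hβ : ∀ᶠ x in 𝓝 (0 : E), β x = 1 := β.eventuallyEq_one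
  have hρ : ∀ᶠ v in 𝓝 o, ρ v = 1 := ρ.eventuallyEq_one
  refine ⟨f, g, hfs, hgs, hf0, hg0, ?_, ?_⟩
  · have hc : Tendsto g (𝓝 0) (𝓝 o) := by
      simpa [hg0] using hgs.continuous.tendsto (0 : E)
    filter_upwards [hβ, hc.eventually hρ] with x hx hx'
    have hr := φ.right_inv (hmem x)
    simp only [f, hx', one_smul]
    rw [hx, one_smul] at hr
    simp only [g, hx, one_smul, hr, add_sub_cancel_left]
  · have hc : Tendsto f (𝓝 o) (𝓝 0) := by
      simpa [hf0] using hfs.continuous.tendsto o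
    filter_upwards [hρ, hc.eventually hβ, extChartAt_source_mem_nhds (I := I) o] with v hv hv' hs
    simp only [g, hv', one_smul]
    simp only [f, hv, one_smul, add_sub_cancel]
    exact φ.left_inv hs

end manifold

namespace GradedSpace

variable (V : GradedSpace.{u}) {F : Type*} [NormedAddCommGroup F] [NormedSpace ℝ F]

/-- The vertex of a graded space: the constant value of `h_0`. -/
def vertex : V.carrier := V.zero_smul_const.choose

variable {V}

@[simp]
lemma zero_smul_eq (v : V.carrier) : (0 : ℝ) • v = V.vertex := V.zero_smul_const.choose_spec v

@[simp]
lemma smul_vertex (t : ℝ) : t • V.vertex = V.vertex := by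
  rw [← zero_smul_eq V.vertex, ← mul_smul, mul_zero]

lemma contMDiff_smul' : ContMDiff (𝓘(ℝ, ℝ).prod (𝓡 V.dim)) (𝓡 V.dim) ∞
    fun p : ℝ × V.carrier => p.1 • p.2 :=
  ContMDiffSMul.contMDiff_smul

lemma contMDiff_smul_left (v : V.carrier) :
    ContMDiff 𝓘(ℝ, ℝ) (𝓡 V.dim) ∞ fun t : ℝ => t • v :=
  contMDiff_smul'.comp (contMDiff_id.prodMk contMDiff_const)

lemma contMDiff_const_smul (t : ℝ) :
    ContMDiff (𝓡 V.dim) (𝓡 V.dim) ∞ fun v : V.carrier => t • v :=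
  contMDiff_smul'.comp (contMDiff_const.prodMk contMDiff_id)

lemma tendsto_smul_vertex (v : V.carrier) :
    Tendsto (fun t : ℝ => t • v) (𝓝 0) (𝓝 V.vertex) := by
  simpa using (contMDiff_smul_left v).continuous.tendsto 0

/-- The `k`-th derivative at `t = 0` of `f` along the orbits `t ↦ h_t v`. -/
def orbitDeriv (f : V.carrier → F) (k : ℕ) (v : V.carrier) : F :=
  iteratedDeriv k (fun t : ℝ => f (t • v)) 0

lemma contMDiff_orbitDeriv {f : V.carrier → F} (hf : ContMDiff (𝓡 V.dim) 𝓘(ℝ, F) ∞ f)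
    (k : ℕ) : ContMDiff (𝓡 V.dim) 𝓘(ℝ, F) ∞ (orbitDeriv f k) := by
  have h : ContMDiff (𝓘(ℝ, ℝ).prod (𝓡 V.dim)) 𝓘(ℝ, F) ∞ fun p : ℝ × V.carrier =>
      iteratedDeriv k (fun t : ℝ => f (t • p.2)) p.1 := by
    induction k with
    | zero =>
      simp only [iteratedDeriv_zero]
      exact hf.comp contMDiff_smul'
    | succ k ih =>
      simp only [iteratedDeriv_succ]
      exact contMDiff_deriv_left ih
  exact h.comp (contMDiff_const.prodMk contMDiff_id)

lemma orbitDeriv_smul {f : V.carrier → F} (hf : ContMDiff (𝓡 V.dim) 𝓘(ℝ, F) ∞ f)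
    (k : ℕ) (t : ℝ) (v : V.carrier) :
    orbitDeriv f k (t • v) = t ^ k • orbitDeriv f k v := by
  have hs : ContDiff ℝ k fun s : ℝ => f (s • v) :=
    ((hf.comp (contMDiff_smul_left v)).contDiff).of_le (mod_cast le_top)
  have h := congrFun (iteratedDeriv_comp_const_smul hs t) 0
  simp only [mul_zero] at h
  rw [orbitDeriv, orbitDeriv, ← h]
  congr 1
  funext s
  rw [smul_smul, mul_comm]

/-- An equivariant smooth map into `ℝ ^ κ` with a positive weighted dilation action is a
diffeomorphism as soon as it has a smooth local inverse at the vertex. -/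
theorem exists_diffeomorph_of_local {κ : Type} [Fintype κ] {w : κ → ℕ} (hw : ∀ i, 0 < w i)
    {Y : V.carrier → κ → ℝ} (hY : ContMDiff (𝓡 V.dim) 𝓘(ℝ, κ → ℝ) ∞ Y)
    (heq : ∀ (t : ℝ) v, Y (t • v) = dilation w t (Y v)) {τ : (κ → ℝ) → V.carrier}
    (hτY : ∀ᶠ v in 𝓝 V.vertex, τ (Y v) = v) (hYτ : ∀ᶠ z in 𝓝 0, Y (τ z) = z)
    (hτ : ∀ m : ℕ, ∀ᶠ z in 𝓝 0, ContMDiffAt 𝓘(ℝ, κ → ℝ) (𝓡 V.dim) m τ z) :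
    ∃ Φ : Diffeomorph (𝓡 V.dim) 𝓘(ℝ, κ → ℝ) V.carrier (κ → ℝ) ∞, ⇑Φ = Y := by
  have hdil (t s : ℝ) (z : κ → ℝ) : dilation w t (dilation w s z) = dilation w (t * s) z := by
    funext i
    simp [mul_pow, mul_assoc]
  have hone (z : κ → ℝ) : dilation w 1 z = z := by funext i; simp
  have hlim (z : κ → ℝ) : Tendsto (fun t => dilation w t z) (𝓝[≠] 0) (𝓝 0) := by
    have := (continuous_dilation w z).tendsto 0
    rw [dilation_zero hw] at this
    exact this.mono_left nhdsWithin_le_nhds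
  have hlimV (v : V.carrier) : Tendsto (fun t : ℝ => t • v) (𝓝[≠] 0) (𝓝 V.vertex) :=
    (tendsto_smul_vertex v).mono_left nhdsWithin_le_nhds
  have hinj : Function.Injective Y := by
    intro v v' h
    obtain ⟨t, ⟨h1, h2⟩, ht⟩ := (((hlimV v).eventually hτY).and ((hlimV v').eventually hτY)).and
      self_mem_nhdsWithin |>.exists
    have : t • v = t • v' := by rw [← h1, ← h2, heq, heq, h]
    rw [← one_smul ℝ v, ← one_smul ℝ v', ← inv_mul_cancel₀ (show t ≠ 0 from ht), mul_smul,
      mul_smul, this]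
  have hsec {t : ℝ} (ht : t ≠ 0) {z : κ → ℝ} (h : Y (τ (dilation w t z)) = dilation w t z) :
      Y (t⁻¹ • τ (dilation w t z)) = z := by
    rw [heq, h, hdil, inv_mul_cancel₀ ht, hone]
  have hsurj : Function.Surjective Y := by
    intro z
    obtain ⟨t, h1, ht⟩ := (((hlim z).eventually hYτ).and self_mem_nhdsWithin).exists
    exact ⟨_, hsec ht h1⟩
  let e := Equiv.ofBijective Y ⟨hinj, hsurj⟩
  refine ⟨⟨e, hY, contMDiff_infty.2 fun m z₀ => ?_⟩, rfl⟩
  obtain ⟨t, ⟨h1, h2⟩, ht⟩ := ((((hlim z₀).eventually hYτ.eventually_nhds).and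
    ((hlim z₀).eventually (hτ m))).and self_mem_nhdsWithin).exists
  have hev : e.symm =ᶠ[𝓝 z₀] fun z => t⁻¹ • τ (dilation w t z) := by
    filter_upwards [((dilation w t).continuous.tendsto z₀).eventually h1] with z hz
    rw [Equiv.symm_apply_eq]
    exact (hsec ht hz).symm
  refine ContMDiffAt.congr_of_eventuallyEq ?_ hev
  have h3 : ContMDiffAt 𝓘(ℝ, κ → ℝ) 𝓘(ℝ, κ → ℝ) m (dilation w t) z₀ :=
    (dilation w t).contDiff.contMDiff.contMDiffAt
  exact ((contMDiff_const_smul t⁻¹).of_le (mod_cast le_top)).contMDiffAt.comp z₀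
    (ContMDiffAt.comp z₀ h2 h3)

end GradedSpace

/-- Indices with positive weights can be sorted by weight. -/
lemma exists_coordIndex_equiv {κ : Type} [Fintype κ] {w : κ → ℕ} (hw : ∀ i, 0 < w i) :
    ∃ (r : ℕ) (d : Fin r → ℕ) (e : CoordIndex d ≃ κ), ∀ s, w (e s) = coordWeight d s := by
  classical
  let r := Finset.univ.sup w
  have hr (i : κ) : w i ≤ r := Finset.le_sup (Finset.mem_univ i)
  let p : κ → Fin r := fun i => ⟨w i - 1, by have := hw i; have := hr i; omega⟩
  let e : CoordIndex (fun j => Fintype.card {i // p i = j}) ≃ κ :=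
    (Equiv.sigmaCongrRight fun j => (Fintype.equivFin {i // p i = j}).symm).trans
      (Equiv.sigmaFiberEquiv p)
  refine ⟨r, _, e, fun s => ?_⟩
  have h : p (e s) = s.1 := ((Fintype.equivFin {i // p i = s.1}).symm s.2).2
  have h' : w (e s) - 1 = s.1 := congrArg Fin.val h
  have := hw (e s)
  rw [coordWeight, ← h']
  omega

namespace GradedSpace

variable (V : GradedSpace.{u})

/-- Homogeneous smooth functions of positive weights whose composition with a local
parametrisation `g` has an invertible differential at the vertex. -/
theorem exists_homogeneous_localCoordinates :
    ∃ (κ : Type) (_ : Fintype κ) (w : κ → ℕ) (Y : V.carrier → κ → ℝ)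
      (f : V.carrier → EuclideanSpace ℝ (Fin V.dim)) (g : EuclideanSpace ℝ (Fin V.dim) → V.carrier)
      (e : EuclideanSpace ℝ (Fin V.dim) ≃L[ℝ] (κ → ℝ)),
      (∀ i, 0 < w i) ∧ ContMDiff (𝓡 V.dim) 𝓘(ℝ, κ → ℝ) ∞ Y ∧
      (∀ (t : ℝ) v, Y (t • v) = dilation w t (Y v)) ∧
      ContMDiff 𝓘(ℝ, EuclideanSpace ℝ (Fin V.dim)) (𝓡 V.dim) ∞ g ∧ g 0 = V.vertex ∧
      Tendsto f (𝓝 V.vertex) (𝓝 0) ∧ (∀ᶠ v in 𝓝 V.vertex, g (f v) = v) ∧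
      HasFDerivAt (Y ∘ g) (e : EuclideanSpace ℝ (Fin V.dim) →L[ℝ] (κ → ℝ)) 0 := by
  obtain ⟨f, g, hf, hg, hf0, hg0, hfg, hgf⟩ :=
    exists_smooth_localInverse (I := 𝓡 V.dim) V.vertex
  let H : ℝ × EuclideanSpace ℝ (Fin V.dim) → EuclideanSpace ℝ (Fin V.dim) :=
    fun p => f (p.1 • g p.2)
  have hH : ContDiff ℝ ∞ H := by
    rw [← contMDiff_iff_contDiff]
    have h := hf.comp (contMDiff_smul'.comp
      ((contMDiff_fst (I := 𝓘(ℝ, ℝ)) (J := 𝓘(ℝ, EuclideanSpace ℝ (Fin V.dim))) (n := ∞)).prodMk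
        (hg.comp contMDiff_snd)))
    rw [modelWithCornersSelf_prod, ← chartedSpaceSelf_prod]
    exact h
  have hHd (t : ℝ) : Differentiable ℝ fun y => H (t, y) :=
    (hH.comp (contDiff_const.prodMk contDiff_id)).differentiable (by simp)
  have hH0 (t : ℝ) : H (t, 0) = 0 := by simp [H, hg0, hf0]
  let L : ℝ → EuclideanSpace ℝ (Fin V.dim) →L[ℝ] EuclideanSpace ℝ (Fin V.dim) :=
    fun t => fderiv ℝ (fun y => H (t, y)) 0
  have hL : ContDiff ℝ ∞ L := contDiff_fderiv_prodMk_right hH 0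
  have hL1 : L 1 = ContinuousLinearMap.id ℝ _ := by
    have h : (fun y => H (1, y)) =ᶠ[𝓝 0] id := by
      filter_upwards [hfg] with x hx
      simpa [H] using hx
    exact h.fderiv_eq.trans fderiv_id
  have hLmul (s t : ℝ) : L (s * t) = (L s).comp (L t) := by
    have hlim : Tendsto (fun y => t • g y) (𝓝 0) (𝓝 V.vertex) := by
      have h : Tendsto (fun y => t • g y) (𝓝 0) (𝓝 (t • g 0)) :=
        ((contMDiff_const_smul t).continuous.comp hg.continuous).tendsto 0
      rwa [hg0, smul_vertex] at h
    have h : (fun y => H (s * t, y)) =ᶠ[𝓝 0] (fun y => H (s, y)) ∘ fun y => H (t, y) := by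
      filter_upwards [hlim.eventually hgf] with y hy
      simp only [H, Function.comp_apply, hy, mul_smul]
    have h2 := h.fderiv_eq (𝕜 := ℝ)
    rw [fderiv_comp 0 (hHd s _) (hHd t _), hH0] at h2
    exact h2
  have hQ (k : ℕ) : HasFDerivAt (fun x => orbitDeriv f k (g x)) (iteratedDeriv k L 0) 0 := by
    have h := fderiv_partialDeriv hH k 0 0
    have hd : Differentiable ℝ fun y => partialDeriv H k (0, y) :=
      ((contDiff_partialDeriv hH k).comp (contDiff_const.prodMk contDiff_id)).differentiable
        (by simp)
    have h2 := (hd 0).hasFDerivAt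
    rw [h] at h2
    exact h2
  have hL0 : L 0 = 0 := by
    have : (fun y => H (0, y)) = fun _ => 0 := by
      funext y
      simp [H, hf0]
    simp only [L, this]
    exact fderiv_const_apply _
  let φ : ℕ × Fin V.dim → Module.Dual ℝ (EuclideanSpace ℝ (Fin V.dim)) := fun j =>
    ((EuclideanSpace.proj j.2 : _ →L[ℝ] ℝ).comp (iteratedDeriv j.1 L 0) :
      EuclideanSpace ℝ (Fin V.dim) →L[ℝ] ℝ)
  obtain ⟨κ, hκ, a, e, he, hne⟩ := exists_linearEquiv_of_separating φ (by
    intro x hx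
    refine eq_zero_of_flat_orbit hL hL1 hLmul fun k => ?_
    ext b
    exact hx (k, b))
  refine ⟨κ, hκ, fun i => (a i).1, fun v i => orbitDeriv f (a i).1 v (a i).2, f, g,
    e.toContinuousLinearEquiv, fun i => ?_, ?_, fun t v => ?_, hg, hg0, ?_, hgf, ?_⟩
  · refine Nat.pos_of_ne_zero fun h => hne i ?_
    ext x
    simp [φ, h, hL0]
  · refine contMDiff_pi_space.2 fun i => ?_
    exact (EuclideanSpace.proj (𝕜 := ℝ) (a i).2).contDiff.contMDiff.comp
      (contMDiff_orbitDeriv hf _)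
  · funext i
    simp [orbitDeriv_smul hf]
  · simpa [hf0] using hf.continuous.tendsto V.vertex
  · rw [hasFDerivAt_pi']
    intro i
    have h := (EuclideanSpace.proj (𝕜 := ℝ) (a i).2).hasFDerivAt.comp 0 (hQ (a i).1)
    exact h.congr_fderiv (ContinuousLinearMap.ext fun x => (he x i).symm)

/-- Every graded space is equivariantly diffeomorphic to some `ℝ ^ 𝐝`. -/
theorem exists_homogeneous_diffeomorph :
    ∃ (r : ℕ) (d : Fin r → ℕ)
      (Φ : Diffeomorph (𝓡 V.dim) 𝓘(ℝ, CoordIndex d → ℝ) V.carrier (CoordIndex d → ℝ) ∞),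
      ∀ (t : ℝ) (v : V.carrier) (s : CoordIndex d), Φ (t • v) s = t ^ coordWeight d s * Φ v s := by
  obtain ⟨κ, _, w, Y, f, g, e, hw, hY, heq, hg, hg0, hf, hgf, hd⟩ :=
    V.exists_homogeneous_localCoordinates
  have hYg : ContDiff ℝ ∞ (Y ∘ g) := (hY.comp hg).contDiff
  have hY0 : Y V.vertex = 0 := by
    rw [← zero_smul_eq V.vertex, heq, dilation_zero hw]
  have hYg0 : (Y ∘ g) 0 = 0 := by simp [hg0, hY0]
  have hn : (∞ : ℕ∞ω) ≠ 0 := by simp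
  let σ := hYg.contDiffAt.localInverse hd hn
  have hσ : ContDiffAt ℝ ∞ σ 0 := by
    have := hYg.contDiffAt.to_localInverse hd hn
    rwa [hYg0] at this
  have hstrict := hYg.contDiffAt.hasStrictFDerivAt' hd hn
  have hl : ∀ᶠ x in 𝓝 0, σ ((Y ∘ g) x) = x := hstrict.eventually_left_inverse
  have hr : ∀ᶠ z in 𝓝 0, (Y ∘ g) (σ z) = z := by
    have := hstrict.eventually_right_inverse
    rwa [hYg0] at this
  obtain ⟨Φ, hΦ⟩ := exists_diffeomorph_of_local hw hY heq (τ := g ∘ σ) (by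
    filter_upwards [hgf, hf.eventually hl] with v h1 h2
    simp only [Function.comp_apply, h1] at h2 ⊢
    rw [h2, h1]) hr (fun m => by
      filter_upwards [(hσ.of_le (m := m) (mod_cast le_top)).eventually (by simp)] with z hz
      exact (hg.of_le (mod_cast le_top)).contMDiffAt.comp z hz.contMDiffAt)
  obtain ⟨r, d, ε, hε⟩ := exists_coordIndex_equiv hw
  let ℓ : (κ → ℝ) ≃L[ℝ] (CoordIndex d → ℝ) :=
    (LinearEquiv.funCongrLeft ℝ ℝ ε).toContinuousLinearEquiv
  refine ⟨r, d, Φ.trans ℓ.toDiffeomorph, fun t v s => ?_⟩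
  change Φ (t • v) (ε s) = t ^ coordWeight d s * Φ v (ε s)
  rw [hΦ, heq, dilation_apply, hε]

end GradedSpace

/-! ## The dual of a graded space is a polynomial algebra -/

lemma MvPolynomial.eq_zero_of_eval_eq_zero_of_interior_nonempty {ι : Type*} [Fintype ι]
    (p : MvPolynomial ι ℝ) {U : Set (ι → ℝ)} (hU : (interior U).Nonempty)
    (h : ∀ x ∈ U, MvPolynomial.eval x p = 0) : p = 0 := by
  obtain ⟨x, hx⟩ := hU
  obtain ⟨r, hr, hball⟩ := Metric.mem_nhds_iff.1 (mem_interior_iff_mem_nhds.1 hx)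
  rw [ball_pi x hr] at hball
  refine MvPolynomial.funext_set (fun i => Metric.ball (x i) r) (fun i => ?_) fun y hy => ?_
  · rw [Real.ball_eq_Ioo]
    exact Set.Ioo_infinite (by linarith)
  · rw [h y (hball hy), map_zero]

/-- A sequence of polynomials, only finitely many of which are nonzero at each point, has only
finitely many nonzero members. -/
lemma MvPolynomial.exists_forall_ge_eq_zero {ι : Type*} [Fintype ι] (p : ℕ → MvPolynomial ι ℝ)
    (h : ∀ x, ∃ N, ∀ i, N ≤ i → MvPolynomial.eval x (p i) = 0) :
    ∃ N, ∀ i, N ≤ i → p i = 0 := by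
  obtain ⟨N, hN⟩ := nonempty_interior_of_iUnion_of_closed
    (f := fun N => {x : ι → ℝ | ∀ i, N ≤ i → MvPolynomial.eval x (p i) = 0})
    (fun N => by
      simp only [Set.ofPred_forall]
      exact isClosed_iInter fun i => isClosed_iInter fun _ =>
        isClosed_eq (MvPolynomial.continuous_eval _) continuous_const)
    (Set.eq_univ_of_forall fun x => Set.mem_iUnion.2 (h x))
  exact ⟨N, fun i hi => (p i).eq_zero_of_eval_eq_zero_of_interior_nonempty hN
    fun x hx => hx i hi⟩

lemma MvPolynomial.contDiff_eval {ι : Type*} [Fintype ι] (p : MvPolynomial ι ℝ) :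
    ContDiff ℝ ∞ fun x : ι → ℝ => MvPolynomial.eval x p := by
  induction p using MvPolynomial.induction_on with
  | C a => simpa using contDiff_const
  | add p q hp hq => simpa using hp.add hq
  | mul_X p s hp => simpa using hp.mul (contDiff_apply ℝ ℝ s)

lemma coeff_epsScale (t : ℝ) (p : Polynomial ℝ) (j : ℕ) :
    (epsScale t p).coeff j = t ^ j * p.coeff j := by
  induction p using Polynomial.induction_on' with
  | add p q hp hq => simp [hp, hq, mul_add]
  | monomial i a =>
    rw [epsScale_monomial, Polynomial.coeff_monomial, Polynomial.coeff_monomial]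
    split_ifs with h
    · rw [h]
    · rw [mul_zero]

section evalHom

open GradedPolynomialAlgebra

variable {r : ℕ} {d : Fin r → ℕ}

lemma coordWeight_pos (s : CoordIndex d) : 0 < coordWeight d s := Nat.succ_pos _

lemma eval_evalHom (t : ℝ) (l : CoordIndex d → ℝ) (p : MvPolynomial (CoordIndex d) ℝ) :
    (evalHom d l p).eval t = MvPolynomial.eval (dilation (coordWeight d) t l) p := by
  have h : (Polynomial.aeval t).comp (evalHom d l) =
      MvPolynomial.aeval (dilation (coordWeight d) t l) := by
    apply MvPolynomial.algHom_ext
    intro s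
    simp [evalHom, mul_comm]
  simpa [Polynomial.aeval_def, Polynomial.eval₂_eq_eval_map, MvPolynomial.aeval_eq_eval] using
    DFunLike.congr_fun h p

lemma eval_one_evalHom (l : CoordIndex d → ℝ) (p : MvPolynomial (CoordIndex d) ℝ) :
    (evalHom d l p).eval 1 = MvPolynomial.eval l p := by
  rw [eval_evalHom]
  congr 2
  funext s
  simp

lemma evalHom_dilation (t : ℝ) (l : CoordIndex d → ℝ) (p : MvPolynomial (CoordIndex d) ℝ) :
    evalHom d (dilation (coordWeight d) t l) p = epsScale t (evalHom d l p) := by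
  have h : evalHom d (dilation (coordWeight d) t l) = (epsScale t).comp (evalHom d l) := by
    apply MvPolynomial.algHom_ext
    intro s
    simp [evalHom, epsScale_monomial]
  rw [h, AlgHom.comp_apply]

lemma evalHom_of_isWeightedHomogeneous {i : ℕ} {p : MvPolynomial (CoordIndex d) ℝ}
    (hp : p.IsWeightedHomogeneous (coordWeight d) i) (l : CoordIndex d → ℝ) :
    evalHom d l p = Polynomial.monomial i (MvPolynomial.eval l p) := by
  obtain ⟨x, hx⟩ := evalHom_mem l hp
  rw [← eval_one_evalHom, ← hx]
  simp

lemma isWeightedHomogeneous_of_evalHom_mem {i : ℕ} {p : MvPolynomial (CoordIndex d) ℝ}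
    (h : ∀ l, evalHom d l p ∈ epsPiece i) : p.IsWeightedHomogeneous (coordWeight d) i := by
  obtain ⟨q, hq, hqe⟩ := exists_isWeightedHomogeneous_eval_eq (w := coordWeight d) (i := i)
    (F := fun x => MvPolynomial.eval x p) coordWeight_pos
    p.contDiff_eval (by
      intro t x
      obtain ⟨c, hc⟩ := h x
      rw [← eval_evalHom, ← eval_one_evalHom x, ← hc]
      simp [mul_comm])
  rwa [← MvPolynomial.funext hqe]

end evalHom

namespace GradedSpace

open GradedPolynomialAlgebra

variable {V : GradedSpace.{u}} {r : ℕ} {d : Fin r → ℕ}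

/-- Homogeneous coordinates on a graded space: an equivariant diffeomorphism with `ℝ ^ 𝐝`. -/
structure Coordinates (V : GradedSpace.{u}) {r : ℕ} (d : Fin r → ℕ) where
  diffeo : Diffeomorph (𝓡 V.dim) 𝓘(ℝ, CoordIndex d → ℝ) V.carrier (CoordIndex d → ℝ) ∞
  map_smul : ∀ (t : ℝ) (v : V.carrier),
    diffeo (t • v) = dilation (coordWeight d) t (diffeo v)

namespace Coordinates

variable (Φ : V.Coordinates d)

/-- Polynomials in homogeneous coordinates as elements of `Hom_𝔾(V, ℝ[ε])`. -/
def polyHom : MvPolynomial (CoordIndex d) ℝ →ₐ[ℝ] V.dual :=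
  (AlgHom.pi (R := ℝ) (A := fun _ : V.carrier => Polynomial ℝ) fun v => evalHom d (Φ.diffeo v)).codRestrict
    V.dual fun p =>
      ⟨(smoothToEps_iff _ _).2 fun j =>
        (contDiff_coeff_evalHom p j).contMDiff.comp Φ.diffeo.contMDiff, fun t v => by
          rw [AlgHom.pi_apply, AlgHom.pi_apply, Φ.map_smul, evalHom_dilation]⟩

lemma polyHom_apply (p : MvPolynomial (CoordIndex d) ℝ) (v : V.carrier) :
    (Φ.polyHom p).1 v = evalHom d (Φ.diffeo v) p := rfl

lemma polyHom_mem_iff (p : MvPolynomial (CoordIndex d) ℝ) (i : ℕ) :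
    Φ.polyHom p ∈ V.dualPiece i ↔
      p ∈ MvPolynomial.weightedHomogeneousSubmodule ℝ (coordWeight d) i := by
  refine ⟨fun h => isWeightedHomogeneous_of_evalHom_mem fun l => ?_, fun h v => evalHom_mem _ h⟩
  have := h (Φ.diffeo.symm l)
  rwa [polyHom_apply, Diffeomorph.apply_symm_apply] at this

lemma polyHom_injective : Function.Injective Φ.polyHom := by
  intro p q h
  refine MvPolynomial.funext fun l => ?_
  have := congrArg (fun α : V.dual => (α.1 (Φ.diffeo.symm l)).eval 1) h
  simpa only [polyHom_apply, eval_one_evalHom, Diffeomorph.apply_symm_apply] using this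

lemma polyHom_surjective : Function.Surjective Φ.polyHom := by
  intro α
  have hp (i : ℕ) : ∃ p : MvPolynomial (CoordIndex d) ℝ,
      p.IsWeightedHomogeneous (coordWeight d) i ∧
        ∀ x, MvPolynomial.eval x p = (α.1 (Φ.diffeo.symm x)).coeff i := by
    refine exists_isWeightedHomogeneous_eval_eq coordWeight_pos ?_ fun t x => ?_
    · exact (((smoothToEps_iff _ _).1 α.2.1 i).comp Φ.diffeo.symm.contMDiff).contDiff
    · have h : Φ.diffeo.symm (dilation (coordWeight d) t x) = t • Φ.diffeo.symm x := by
        apply Φ.diffeo.injective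
        change Φ.diffeo _ = Φ.diffeo _
        rw [Φ.map_smul, Diffeomorph.apply_symm_apply, Diffeomorph.apply_symm_apply]
      rw [h, α.2.2, coeff_epsScale]
  choose p hph hpe using hp
  obtain ⟨N, hN⟩ := MvPolynomial.exists_forall_ge_eq_zero p fun x =>
    ⟨(α.1 (Φ.diffeo.symm x)).natDegree + 1, fun i hi => by
      rw [hpe]
      exact Polynomial.coeff_eq_zero_of_natDegree_lt hi⟩
  refine ⟨∑ i ∈ Finset.range N, p i, Subtype.ext (funext fun v => ?_)⟩
  rw [polyHom_apply, map_sum]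
  ext j
  simp only [evalHom_of_isWeightedHomogeneous (hph _), hpe, Diffeomorph.symm_apply_apply,
    Polynomial.finsetSum_coeff, Polynomial.coeff_monomial, Finset.sum_ite_eq', Finset.mem_range]
  split_ifs with hj
  · rfl
  · have := hpe j (Φ.diffeo v)
    rw [hN j (not_lt.1 hj), map_zero, Diffeomorph.symm_apply_apply] at this
    exact this

/-- Homogeneous coordinates on `V` give graded coordinates on `Hom_𝔾(V, ℝ[ε])`. -/
def dualCoordinates : GradedCoordinates V.dualPiece d where
  equiv := (AlgEquiv.ofBijective Φ.polyHom ⟨Φ.polyHom_injective, Φ.polyHom_surjective⟩).symm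
  mem_piece_iff i a := by
    rw [← Φ.polyHom_mem_iff]
    exact iff_of_eq (congrArg (· ∈ V.dualPiece i)
      ((AlgEquiv.ofBijective Φ.polyHom _).apply_symm_apply a).symm)

end Coordinates

theorem exists_coordinates (V : GradedSpace.{u}) :
    ∃ (r : ℕ) (d : Fin r → ℕ), Nonempty (V.Coordinates d) := by
  obtain ⟨r, d, Φ, hΦ⟩ := V.exists_homogeneous_diffeomorph
  exact ⟨r, d, ⟨⟨Φ, fun t v => funext (hΦ t v)⟩⟩⟩

end GradedSpace

/-- An algebra with graded coordinates is a graded algebra. -/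
theorem GradedCoordinates.nonempty_gradedAlgebra {A : Type*} [CommRing A] [Algebra ℝ A]
    {𝒜 : ℕ → Submodule ℝ A} {r : ℕ} {d : Fin r → ℕ} (c : GradedCoordinates 𝒜 d) :
    Nonempty (GradedAlgebra 𝒜) := by
  let _ : GradedAlgebra (MvPolynomial.weightedHomogeneousSubmodule ℝ (coordWeight d)) :=
    MvPolynomial.weightedGradedAlgebra ℝ (coordWeight d)
  set ℬ := MvPolynomial.weightedHomogeneousSubmodule ℝ (coordWeight d) with hℬ
  have hmon : SetLike.GradedMonoid 𝒜 :=
    { one_mem := by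
        rw [c.mem_piece_iff, map_one]
        exact SetLike.GradedOne.one_mem
      mul_mem := fun i j a b ha hb => by
        rw [c.mem_piece_iff] at ha hb ⊢
        rw [map_mul]
        exact SetLike.GradedMul.mul_mem ha hb }
  let σ (i : ℕ) : ℬ i →ₗ[ℝ] 𝒜 i :=
    (c.equiv.symm.toLinearMap.comp (ℬ i).subtype).codRestrict (𝒜 i) fun p => by
      rw [c.mem_piece_iff]
      simp
  have hσ : DirectSum.coeLinearMap 𝒜 ∘ₗ DirectSum.lmap σ =
      c.equiv.symm.toLinearMap ∘ₗ DirectSum.coeLinearMap ℬ := by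
    ext i x
    simp [σ]
  have hdec : DirectSum.coeLinearMap ℬ ∘ₗ (DirectSum.decomposeLinearEquiv ℬ).toLinearMap =
      .id :=
    LinearMap.ext (DirectSum.decomposeLinearEquiv ℬ).symm_apply_apply
  refine ⟨{ hmon, DirectSum.Decomposition.ofLinearMap 𝒜
    (DirectSum.lmap σ ∘ₗ (DirectSum.decomposeLinearEquiv ℬ).toLinearMap ∘ₗ
      c.equiv.toLinearMap) ?_ ?_ with }⟩
  · rw [← LinearMap.comp_assoc, hσ, LinearMap.comp_assoc, ← LinearMap.comp_assoc _ _
      (DirectSum.coeLinearMap ℬ), hdec]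
    ext a
    simp
  · refine DirectSum.linearMap_ext _ fun i => LinearMap.ext fun a => ?_
    have ha : c.equiv a.1 ∈ ℬ i := (c.mem_piece_iff i a.1).1 a.2
    simp only [LinearMap.comp_apply, DirectSum.coeLinearMap_lof, AlgEquiv.toLinearMap_apply,
      LinearEquiv.coe_coe, DirectSum.decomposeLinearEquiv_apply]
    rw [DirectSum.decompose_of_mem ℬ ha, DirectSum.lmap_of, LinearMap.id_apply,
      DirectSum.lof_eq_of]
    congr 1
    exact Subtype.ext (c.equiv.symm_apply_apply a.1)

/-- `Hom_𝔾(V, ℝ[ε])` is a graded polynomial algebra. -/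
theorem GradedSpace.isGradedPolynomialAlgebra_dual (V : GradedSpace.{u}) :
    IsGradedPolynomialAlgebra V.dualPiece := by
  obtain ⟨r, d, ⟨Φ⟩⟩ := V.exists_coordinates
  exact ⟨Φ.dualCoordinates.nonempty_gradedAlgebra, r, d, ⟨Φ.dualCoordinates⟩⟩

/-! ## The duality -/

namespace GradedPolynomialAlgebra

variable {A : GradedPolynomialAlgebra.{u}} {r : ℕ} {d : Fin r → ℕ}

/-- Graded coordinates on `A` give homogeneous coordinates on `Hom_gr(A, ℝ[ε])`. -/
def dualSpaceCoordinates (c : GradedCoordinates A.piece d) : A.dualSpace.Coordinates d where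
  diffeo :=
    { toEquiv := dualCoordEquiv c
      contMDiff_toFun := contMDiff_pi_space.2 fun _ => A.contMDiff_coeff _ _
      contMDiff_invFun := A.contMDiff_into_dual fun _ =>
        (contDiff_coeff_evalHom (c.equiv _) _).contMDiff }
  map_smul t ψ := funext fun s => dualCoord_smul c t ψ s

lemma evAlg_eq_polyHom (c : GradedCoordinates A.piece d) (a : A.carrier) :
    evAlg A a = (dualSpaceCoordinates c).polyHom (c.equiv a) :=
  Subtype.ext (funext fun ψ => dual_apply c ψ a)

/-- A bijective morphism which also reflects the degrees is an isomorphism. -/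
lemma isIso_of_bijective {A B : GradedPolynomialAlgebra.{u}} (φ : A ⟶ B)
    (hφ : Function.Bijective (Hom.gr φ))
    (hmem : ∀ i a, Hom.gr φ a ∈ B.piece i → a ∈ A.piece i) : IsIso φ := by
  let e : A.carrier ≃ₐ[ℝ] B.carrier := AlgEquiv.ofBijective (Hom.gr φ).toAlgHom hφ
  let ψ : B.piece →ₐᵍ[ℝ] A.piece := ⟨e.symm.toAlgHom, fun {i b} hb => by
    refine hmem i _ ?_
    exact (e.apply_symm_apply b).symm ▸ hb⟩
  exact ⟨(ψ : B ⟶ A), DFunLike.ext (F := A.piece →ₐᵍ[ℝ] A.piece) _ _ e.symm_apply_apply,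
    DFunLike.ext (F := B.piece →ₐᵍ[ℝ] B.piece) _ _ e.apply_symm_apply⟩

end GradedPolynomialAlgebra

namespace GradedSpace

/-- An equivariant map which is a homogeneous coordinate system followed by the inverse of
another one is an isomorphism. -/
lemma Coordinates.isIso {V W : GradedSpace.{u}} {r : ℕ} {d : Fin r → ℕ} (Φ : V.Coordinates d)
    (Ψ : W.Coordinates d) (f : V ⟶ W) (hf : ∀ v, Ψ.diffeo (f.toFun v) = Φ.diffeo v) :
    IsIso f := by
  have hinv (w : W.carrier) : f.toFun (Φ.diffeo.symm (Ψ.diffeo w)) = w := by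
    apply Ψ.diffeo.injective
    exact (hf _).trans (Φ.diffeo.apply_symm_apply _)
  have hinv' (v : V.carrier) : Φ.diffeo.symm (Ψ.diffeo (f.toFun v)) = v := by
    rw [hf, Diffeomorph.symm_apply_apply]
  let g : W ⟶ V :=
    ⟨fun w => Φ.diffeo.symm (Ψ.diffeo w), Φ.diffeo.symm.contMDiff.comp Ψ.diffeo.contMDiff,
      fun t w => by
        conv_lhs => rw [← hinv w, ← f.map_smul, hinv']⟩
  exact ⟨g, Hom.ext (funext hinv'), Hom.ext (funext hinv)⟩

end GradedSpace

section duality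

open GradedPolynomialAlgebra

variable (h : ∀ V : GradedSpace.{u}, IsGradedPolynomialAlgebra V.dualPiece)

/-- The evaluation map of a graded space as a morphism. -/
def evSpaceHom (V : GradedSpace.{u}) :
    V ⟶ ((gDualFunctor h).rightOp ⋙ algDualFunctor).obj V where
  toFun := evSpace h V
  smooth := contMDiff_into_dual _ fun s =>
    (V.smoothToEps_iff _).1
      (((someCoord ((gDualFunctor h).obj (op V))).equiv.symm (MvPolynomial.X s) : V.dual).2.1) _
  map_smul t v := DFunLike.ext (F := ((gDualFunctor h).obj (op V)).Dual) _ _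
    fun α : V.dual => α.2.2 t v

instance (V : GradedSpace.{u}) : IsIso (evSpaceHom h V) := by
  obtain ⟨r, d, ⟨Φ⟩⟩ := V.exists_coordinates
  refine Φ.isIso (dualSpaceCoordinates (A := (gDualFunctor h).obj (op V)) Φ.dualCoordinates)
    _ fun v => funext fun s => ?_
  change ((Φ.polyHom (MvPolynomial.X s)).1 v).coeff (coordWeight d s) = _
  rw [Φ.polyHom_apply, evalHom, MvPolynomial.aeval_X, Polynomial.coeff_monomial_same]

/-- The evaluation maps of graded spaces are natural isomorphisms. -/
def evSpaceIso : 𝟭 GradedSpace.{u} ≅ (gDualFunctor h).rightOp ⋙ algDualFunctor :=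
  NatIso.ofComponents (fun V => (asIso (evSpaceHom h V) : V ≅ _)) fun _ => rfl

/-- The evaluation map of a graded polynomial algebra as a morphism. -/
def evAlgHom (A : GradedPolynomialAlgebra.{u}) :
    A ⟶ (algDualFunctor.rightOp ⋙ gDualFunctor h).obj A :=
  letI := (h A.dualSpace).1.some
  (⟨{ toFun := evAlg A
      map_one' := Subtype.ext (funext fun ψ : A.Dual => map_one ψ)
      map_mul' := fun a b => Subtype.ext (funext fun ψ : A.Dual => map_mul ψ a b)
      map_zero' := Subtype.ext (funext fun ψ : A.Dual => map_zero ψ)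
      map_add' := fun a b => Subtype.ext (funext fun ψ : A.Dual => map_add ψ a b)
      commutes' := fun t => Subtype.ext (funext fun ψ : A.Dual => AlgHomClass.commutes ψ t) },
    fun ha ψ => Dual.map_mem ψ ha⟩ : A.piece →ₐᵍ[ℝ] A.dualSpace.dualPiece)

instance (A : GradedPolynomialAlgebra.{u}) : IsIso (evAlgHom h A) := by
  have c := A.someCoord
  have he : (Hom.gr (evAlgHom h A) : A.carrier → A.dualSpace.dual) =
      (dualSpaceCoordinates c).polyHom ∘ c.equiv :=
    funext (evAlg_eq_polyHom c)
  refine isIso_of_bijective _ ?_ fun i a ha => ?_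
  · exact he ▸ Function.Bijective.comp ⟨(dualSpaceCoordinates c).polyHom_injective,
      (dualSpaceCoordinates c).polyHom_surjective⟩ c.equiv.bijective
  · rw [c.mem_piece_iff, ← (dualSpaceCoordinates c).polyHom_mem_iff, ← evAlg_eq_polyHom]
    exact ha

/-- The evaluation maps of graded polynomial algebras are natural isomorphisms. -/
def evAlgIso : 𝟭 GradedPolynomialAlgebra.{u} ≅ algDualFunctor.rightOp ⋙ gDualFunctor h :=
  NatIso.ofComponents (fun A => (asIso (evAlgHom h A) : A ≅ _)) fun _ => rfl

/-- The duality between graded spaces and graded polynomial algebras. -/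
def gradedDuality : GradedSpace.{u} ≌ GradedPolynomialAlgebra.{u}ᵒᵖ :=
  CategoryTheory.Equivalence.mk (gDualFunctor h).rightOp algDualFunctor (evSpaceIso h)
    (NatIso.ofComponents (fun A => ((evAlgIso h).app A.unop).op) fun φ =>
      Quiver.Hom.unop_inj ((evAlgIso h).hom.naturality φ.unop).symm)

end duality

end

theorem mainTheorem8 :
    -- every system of graded coordinates on `A` identifies the graded space `Hom_gr(A, ℝ[ε])`
    -- with `ℝ ^ 𝐝`, diffeomorphically and equivariantly
    (∀ (A : GradedPolynomialAlgebra.{u}) (r : ℕ) (d : Fin r → ℕ)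
        (c : GradedCoordinates A.piece d),
      ∃ Φ : Diffeomorph (𝓡 A.dualSpace.dim) 𝓘(ℝ, CoordIndex d → ℝ)
          A.dualSpace.carrier (CoordIndex d → ℝ) ∞,
        (∀ (ψ : A.Dual) (s : CoordIndex d),
          Polynomial.monomial (coordWeight d s) (Φ ψ s) =
            ψ (c.equiv.symm (MvPolynomial.X s))) ∧
        (∀ (t : ℝ) (ψ : A.dualSpace.carrier) (s : CoordIndex d),
          Φ (t • ψ) s = t ^ coordWeight d s * Φ ψ s)) ∧
    -- `Hom_𝔾(V, ℝ[ε])` is a graded polynomial algebra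
    ∃ h : ∀ V : GradedSpace.{u}, IsGradedPolynomialAlgebra V.dualPiece,
      -- the evaluation maps are natural isomorphisms
      (∃ η : 𝟭 GradedSpace.{u} ≅ (gDualFunctor h).rightOp ⋙ algDualFunctor,
        ∀ (V : GradedSpace.{u}) (v : V.carrier), (η.hom.app V).toFun v = evSpace h V v) ∧
      (∃ θ : 𝟭 GradedPolynomialAlgebra.{u} ≅ algDualFunctor.rightOp ⋙ gDualFunctor h,
        ∀ (A : GradedPolynomialAlgebra.{u}) (a : A.carrier),
          GradedPolynomialAlgebra.Hom.gr (θ.hom.app A) a = evAlg A a) ∧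
      -- the two functors form an equivalence with the opposite category
      (∃ e : GradedSpace.{u} ≌ GradedPolynomialAlgebra.{u}ᵒᵖ,
        e.functor = (gDualFunctor h).rightOp ∧ e.inverse = algDualFunctor) := by
  refine ⟨fun A r d c => ⟨(GradedPolynomialAlgebra.dualSpaceCoordinates c).diffeo,
    fun ψ s => (GradedPolynomialAlgebra.dual_apply_gen c ψ s).symm,
    fun t ψ s => GradedPolynomialAlgebra.dualCoord_smul c t ψ s⟩,
    GradedSpace.isGradedPolynomialAlgebra_dual, ?_⟩
  set h := GradedSpace.isGradedPolynomialAlgebra_dual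
  exact ⟨⟨evSpaceIso h, fun _ _ => rfl⟩, ⟨evAlgIso h, fun _ _ => rfl⟩,
    ⟨gradedDuality h, rfl, rfl⟩⟩
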